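/- Let $n\ge 2$, let $P$ be a real $n\times n$ matrix all of whose eigenvalues have positive real part, $\gamma=\operatorname{tr}P$, $A_t=t^P=\exp((\log t)P)$ for $t>0$, and let $\rho:\mathbb R^n\to[0,\infty)$ be a quasi-distance associated with $P$: $\rho$ is measurable, $\rho(x)=0$ iff $x=0$, $\rho(x-y)=\rho(y-x)$, $\rho(x-y)\le k(\rho(x-z)+\rho(y-z))$ for some constant $k$ and all $x,y,z$, and $\rho(A_tx)=t\rho(x)$ for all $t>0$ and $x$. Put $E(x,r)=\{y:\rho(x-y)<r\}$ and let $|\cdot|$ be Lebesgue measure. For $0<\alpha<\gamma$ define $$M_\alpha^Pf(x)=\sup_{t>0}|E(x,t)|^{-1+\frac{\alpha}{\gamma}}\int_{E(x,t)}|f(y)|\,dy,\qquad I_\alpha^Pf(x)=\int_{\mathbb R^n}\frac{f(y)}{\rho(x-y)^{\gamma-\alpha}}\,dy .$$ For $1\le p<\infty$ and a positive measurable function $\varphi$ on $\mathbb R^n\times(0,\infty)$, let $M_{p,\varphi,P}$ be the space of all $f\in L_p^{loc}(\mathbb R^n)$ with $$\|f\|_{M_{p,\varphi,P}}=\sup_{x\in\mathbb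 R^n,\,r>0}\varphi(x,r)^{-1}|E(x,r)|^{-\frac1p}\|f\|_{L_p(E(x,r))}<\infty,$$ and let $WM_{p,\varphi,P}$ be the space of all $f\in WL_p^{loc}(\mathbb R^n)$ with $$\|f\|_{WM_{p,\varphi,P}}=\sup_{x\in\mathbb R^n,\,r>0}\varphi(x,r)^{-1}|E(x,r)|^{-\frac1p}\|f\|_{WL_p(E(x,r))}<\infty,$$ where $\|f\|_{WL_p(E)}=\sup_{s>0}s\,|\{y\in E:|f(y)|>s\}|^{1/p}$. Let $1\le p<q<\infty$ and $0<\alpha<\gamma/p$, and let $\varphi$ be a positive measurable function on $\mathbb R^n\times(0,\infty)$ such that, for a constant $C$ independent of $x\in\mathbb R^n$ and $r>0$, $$\sup_{r<t<\infty}t^{-\gamma}\operatorname*{ess\,inf}_{t<\tau<\infty}\varphi(x,\tau)\,\tau^{\gamma}\le C\varphi(x,r),\qquad \int_r^\infty t^{\alpha}\varphi(x,t)^{\frac1p}\,\frac{dt}{t}\le C r^{-\frac{\alpha p}{q-p}} .$$ If $p>1$, then $M_\alpha^P$ and $I_\alpha^P$ are bounded from $M_{p,\varphi^{1/p},P}$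 to $M_{q,\varphi^{1/q},P}$. If $p=1$, then $M_\alpha^P$ and $I_\alpha^P$ are bounded from $M_{1,\varphi,P}$ to $WM_{q,\varphi^{1/q},P}$. That is, there is a constant $C'$ such that for every $f$ in the source space, the integral $I_\alpha^Pf(x)$ converges absolutely for almost every $x$, $M_\alpha^Pf$ and $I_\alpha^Pf$ belong to the target space, and the norm of each in the target space is at most $C'$ times the norm of $f$. -/

import Mathlib

open MeasureTheory Set
open scoped ENNReal NNReal

noncomputable section

/-- The dilation `A_t = t ^ P = exp ((log t) P)` of `ℝⁿ`, for `t > 0`.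
Only the linear, topological, measurable structure and Lebesgue measure of `ℝⁿ` are used below, so
`ℝⁿ` is modelled as `Fin n → ℝ`. -/
def parabolicDilation {n : ℕ} (P : Matrix (Fin n) (Fin n) ℝ) (t : ℝ) (x : Fin n → ℝ) : Fin n → ℝ :=
  (NormedSpace.exp (Real.log t • P)).mulVec x

/-- `ρ` is a (translation invariant, measurable) quasi-distance `(x, y) ↦ ρ (x - y)` on `ℝⁿ` that is
homogeneous of degree one with respect to the dilations `A_t = t ^ P`. -/
structure IsParabolicQuasiDist {n : ℕ} (P : Matrix (Fin n) (Fin n) ℝ) (ρ : (Fin n → ℝ) → ℝ) :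
    Prop where
  measurable : Measurable ρ
  nonneg : ∀ x, 0 ≤ ρ x
  eq_zero_iff : ∀ x, ρ x = 0 ↔ x = 0
  sub_comm : ∀ x y, ρ (x - y) = ρ (y - x)
  quasi_triangle : ∃ k : ℝ, ∀ x y z, ρ (x - y) ≤ k * (ρ (x - z) + ρ (y - z))
  dilation : ∀ t, 0 < t → ∀ x, ρ (parabolicDilation P t x) = t * ρ x

/-- The ellipsoid `E(x, r)`. -/
def ellipsoid {n : ℕ} (ρ : (Fin n → ℝ) → ℝ) (x : Fin n → ℝ) (r : ℝ) : Set (Fin n → ℝ) :=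
  {y | ρ (x - y) < r}

/-- The parabolic fractional maximal function, as a function with values in `[0, ∞]`. -/
def parabolicFracMaximal {n : ℕ} {𝕜 : Type*} [RCLike 𝕜] (P : Matrix (Fin n) (Fin n) ℝ)
    (ρ : (Fin n → ℝ) → ℝ) (α : ℝ) (f : (Fin n → ℝ) → 𝕜) (x : Fin n → ℝ) : ℝ≥0∞ :=
  ⨆ (t : ℝ) (_ : 0 < t),
    volume (ellipsoid ρ x t) ^ (-1 + α / P.trace) * ∫⁻ y in ellipsoid ρ x t, ‖f y‖ₑ

/-- The integrand `f(y) / ρ(x - y) ^ (γ - α)`, `γ = tr P`, of the parabolic fractional integral. -/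
def parabolicFracKernel {n : ℕ} {𝕜 : Type*} [RCLike 𝕜] (P : Matrix (Fin n) (Fin n) ℝ)
    (ρ : (Fin n → ℝ) → ℝ) (α : ℝ) (f : (Fin n → ℝ) → 𝕜) (x y : Fin n → ℝ) : 𝕜 :=
  (ρ (x - y) ^ (P.trace - α))⁻¹ • f y

/-- The parabolic fractional integral. -/
def parabolicFracIntegral {n : ℕ} {𝕜 : Type*} [RCLike 𝕜] (P : Matrix (Fin n) (Fin n) ℝ)
    (ρ : (Fin n → ℝ) → ℝ) (α : ℝ) (f : (Fin n → ℝ) → 𝕜) (x : Fin n → ℝ) : 𝕜 :=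
  ∫ y, parabolicFracKernel P ρ α f x y

section Spaces

variable {n : ℕ} {ε : Type*} [TopologicalSpace ε] [ContinuousENorm ε]

/-- The norm of `L_p(E)`. -/
def strongNormOn (p : ℝ) (f : (Fin n → ℝ) → ε) (E : Set (Fin n → ℝ)) : ℝ≥0∞ :=
  eLpNorm f (ENNReal.ofReal p) (volume.restrict E)

/-- The quasi-norm `sup_{s > 0} s |{y ∈ E : |f y| > s}| ^ (1/p)` of the weak space `WL_p(E)`. -/
def weakNormOn (p : ℝ) (f : (Fin n → ℝ) → ε) (E : Set (Fin n → ℝ)) : ℝ≥0∞ :=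
  ⨆ s : ℝ≥0, (s : ℝ≥0∞) * volume {y | y ∈ E ∧ (s : ℝ≥0∞) < ‖f y‖ₑ} ^ (1 / p)

/-- The norm of the parabolic generalized Morrey space `M_{p,φ,P}`. -/
def morreyNorm (ρ : (Fin n → ℝ) → ℝ) (p : ℝ) (φ : (Fin n → ℝ) → ℝ → ℝ) (f : (Fin n → ℝ) → ε) :
    ℝ≥0∞ :=
  ⨆ (x : Fin n → ℝ) (r : ℝ) (_ : 0 < r),
    ENNReal.ofReal (φ x r)⁻¹ * volume (ellipsoid ρ x r) ^ (-(1 / p)) *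
      strongNormOn p f (ellipsoid ρ x r)

/-- The quasi-norm of the weak parabolic generalized Morrey space `WM_{p,φ,P}`. -/
def weakMorreyNorm (ρ : (Fin n → ℝ) → ℝ) (p : ℝ) (φ : (Fin n → ℝ) → ℝ → ℝ)
    (f : (Fin n → ℝ) → ε) : ℝ≥0∞ :=
  ⨆ (x : Fin n → ℝ) (r : ℝ) (_ : 0 < r),
    ENNReal.ofReal (φ x r)⁻¹ * volume (ellipsoid ρ x r) ^ (-(1 / p)) *
      weakNormOn p f (ellipsoid ρ x r)

/-- `f ∈ M_{p,φ,P}`: `f` is (a.e. strongly) measurable, locally in `L_p`, with finite norm. -/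
def MemMorrey (ρ : (Fin n → ℝ) → ℝ) (p : ℝ) (φ : (Fin n → ℝ) → ℝ → ℝ) (f : (Fin n → ℝ) → ε) :
    Prop :=
  AEStronglyMeasurable f volume ∧ (∀ K, IsCompact K → strongNormOn p f K < ∞) ∧
    morreyNorm ρ p φ f < ∞

/-- `f ∈ WM_{p,φ,P}`: `f` is (a.e. strongly) measurable, locally in `WL_p`, with finite norm. -/
def MemWeakMorrey (ρ : (Fin n → ℝ) → ℝ) (p : ℝ) (φ : (Fin n → ℝ) → ℝ → ℝ)
    (f : (Fin n → ℝ) → ε) : Prop :=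
  AEStronglyMeasurable f volume ∧ (∀ K, IsCompact K → weakNormOn p f K < ∞) ∧
    weakMorreyNorm ρ p φ f < ∞

end Spaces

/-- `sup_{r < t < ∞} t ^ (-γ) essinf_{t < τ < ∞} φ(x, τ) τ ^ γ ≤ C φ(x, r)`, with `C` independent of
`x` and `r > 0`. -/
def MorreySupCondition {n : ℕ} (γ : ℝ) (φ : (Fin n → ℝ) → ℝ → ℝ) : Prop :=
  ∃ C : ℝ, ∀ (x : Fin n → ℝ) (r : ℝ), 0 < r →
    (⨆ (t : ℝ) (_ : r < t), ENNReal.ofReal (t ^ (-γ)) *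
      essInf (fun τ : ℝ => ENNReal.ofReal (φ x τ * τ ^ γ)) (volume.restrict (Ioi t)))
    ≤ ENNReal.ofReal (C * φ x r)

/-- `∫_r^∞ t ^ α φ(x, t) ^ (1/p) dt/t ≤ C r ^ (-αp/(q-p))`, with `C` independent of `x` and
`r > 0`. -/
def MorreyIntegralCondition {n : ℕ} (α p q : ℝ) (φ : (Fin n → ℝ) → ℝ → ℝ) : Prop :=
  ∃ C : ℝ, ∀ (x : Fin n → ℝ) (r : ℝ), 0 < r →
    (∫⁻ t in Ioi r, ENNReal.ofReal (t ^ α * φ x t ^ (1 / p) / t))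
    ≤ ENNReal.ofReal (C * r ^ (-(α * p / (q - p))))

end

/-! ### Matrix exponentials: decay of `exp (-k P)` and the determinant of `exp (s P)`. -/

section MatrixExponential

open Filter Topology
open scoped Matrix.Norms.Operator

variable {n : ℕ}

/-! The argument is Hedberg's. Put β = γ - α, g = |f|, and let K g(x) = ∫₀^∞ t^(-β-1) ∫_{E(x,t)} g
dt (`ellipsoidPotential`). Both operators are pointwise at most a constant times K g, so only K has
to be estimated. Cut the t-integral at r. The part t ≤ r is at most C r^α M g(x), where M is the
Hardy–Littlewood maximal function over ellipsoids; the part t > r is, by Hölder and the integral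
condition, at most C ‖f‖ r^(-αp/(q-p)) (`exists_ellipsoidPotential_le`). Balancing the two gives K g
≤ C (M g)^(p/q) ‖f‖^(1-p/q) wherever M g is finite (`ENNReal.le_mul_rpow_mul_rpow_of_forall_le`).
Taking q-th powers leaves (M g)^p, so it remains to bound M on the source Morrey space, strongly for
p > 1 and weakly for p = 1 (`exists_morrey_strong`, `exists_morrey_weak`).

For that, g is split at E(x, 2kr). The inner part is handled by the weak (1,1) inequality, from a
Vitali covering, or by the strong (p,p) inequality deduced from it by truncation. For the outer part
the supremum condition allows φ(x,t) to be replaced by C φ(x,r) when t > r, because ∫_{E(x,t)} g^p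
increases with t (`setLIntegral_ellipsoid_le_of_morreySupCondition`).

All of this rests on |E(x,r)| = c r^γ with 0 < c < ∞ (`exists_volume_ellipsoid`). The power comes
from det exp(sP) = exp(s tr P). Positivity of c comes from Steinhaus' theorem, ρ being only
measurable, and finiteness from the decay of exp(-kP). -/

lemma mulVec_pow_of_mulVec_eq_smul {A : Matrix (Fin n) (Fin n) ℂ} {v : Fin n → ℂ} {z : ℂ}
    (h : A.mulVec v = z • v) (k : ℕ) : (A ^ k).mulVec v = z ^ k • v := by
  induction k with
  | zero => simp
  | succ k ih =>
    rw [pow_succ, ← Matrix.mulVec_mulVec, h, Matrix.mulVec_smul, ih, smul_smul, pow_succ, mul_comm]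

lemma exp_mulVec_of_mulVec_eq_smul {A : Matrix (Fin n) (Fin n) ℂ} {v : Fin n → ℂ} {z : ℂ}
    (h : A.mulVec v = z • v) : (NormedSpace.exp A).mulVec v = Complex.exp z • v := by
  have h1 : HasSum (fun k : ℕ => (((k.factorial : ℂ))⁻¹ • A ^ k)) (NormedSpace.exp A) :=
    NormedSpace.exp_series_hasSum_exp' (𝕂 := ℂ) A
  have h2 : HasSum (fun k : ℕ => (((k.factorial : ℂ))⁻¹ • z ^ k)) (Complex.exp z) := by
    rw [Complex.exp_eq_exp_ℂ]; exact NormedSpace.exp_series_hasSum_exp' (𝕂 := ℂ) z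
  have hc : Continuous fun M : Matrix (Fin n) (Fin n) ℂ => M.mulVec v :=
    Continuous.matrix_mulVec continuous_id continuous_const
  have h3 := h1.map (Matrix.mulVecBilin ℂ ℂ |>.flip v : Matrix (Fin n) (Fin n) ℂ →ₗ[ℂ] Fin n → ℂ) hc
  have h4 := h2.smul_const v
  refine h3.unique ?_
  convert h4 using 1
  ext1 k
  simp [mulVec_pow_of_mulVec_eq_smul h, smul_smul]

/-- A commutes with exp A, so it preserves the w-eigenspace of exp A. Over ℂ it has an eigenvector
there, and exp A acts on that vector by the exponential of its A-eigenvalue. -/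
lemma exists_mem_spectrum_of_mem_spectrum_exp {A : Matrix (Fin n) (Fin n) ℂ} {w : ℂ}
    (hw : w ∈ spectrum ℂ (NormedSpace.exp A)) : ∃ z ∈ spectrum ℂ A, Complex.exp z = w := by
  rw [← Matrix.spectrum_toLin', ← Module.End.hasEigenvalue_iff_mem_spectrum] at hw
  set S : Module.End ℂ (Fin n → ℂ) := Matrix.toLin' (NormedSpace.exp A)
  set T : Module.End ℂ (Fin n → ℂ) := Matrix.toLin' A
  have hcomm : Commute S T := by
    have : Commute (NormedSpace.exp A) A := (Commute.refl A).exp_left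
    change Matrix.toLin' _ * Matrix.toLin' _ = Matrix.toLin' _ * Matrix.toLin' _
    rw [Module.End.mul_eq_comp, Module.End.mul_eq_comp, ← Matrix.toLin'_mul, ← Matrix.toLin'_mul,
      this.eq]
  have hmap : MapsTo T (S.eigenspace w) (S.eigenspace w) :=
    Module.End.mapsTo_genEigenspace_of_comm hcomm w 1
  have hnt : Nontrivial (S.eigenspace w) := by
    rw [Submodule.nontrivial_iff_ne_bot]; exact hw
  obtain ⟨z, hz⟩ := Module.End.exists_eigenvalue (T.restrict hmap)
  obtain ⟨u, hu⟩ := hz.exists_hasEigenvector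
  have hTu : A.mulVec (u : Fin n → ℂ) = z • (u : Fin n → ℂ) := by
    have := congrArg Subtype.val hu.apply_eq_smul
    exact this
  have hu0 : (u : Fin n → ℂ) ≠ 0 := by
    intro h; exact hu.2 (Subtype.ext h)
  refine ⟨z, ?_, ?_⟩
  · rw [← Matrix.spectrum_toLin', ← Module.End.hasEigenvalue_iff_mem_spectrum]
    refine Module.End.hasEigenvalue_of_hasEigenvector (x := (u : Fin n → ℂ)) ⟨?_, hu0⟩
    rw [Module.End.mem_eigenspace_iff]
    simpa using hTu
  · have h1 := exp_mulVec_of_mulVec_eq_smul hTu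
    have h2 : S (u : Fin n → ℂ) = w • (u : Fin n → ℂ) := Module.End.mem_eigenspace_iff.1 u.2
    rw [Matrix.toLin'_apply, h1] at h2
    exact smul_left_injective ℂ hu0 h2

/-- Gelfand's formula: the spectral radius is below some r < 1, hence ‖A^k‖ ≤ r^k eventually. -/
lemma tendsto_pow_zero_of_spectrum [NeZero n] {A : Matrix (Fin n) (Fin n) ℂ}
    (hA : ∀ z ∈ spectrum ℂ A, ‖z‖₊ < 1) : Tendsto (fun k : ℕ => A ^ k) atTop (𝓝 0) := by
  have h1 : spectralRadius ℂ A < (1 : ℝ≥0) := spectrum.spectralRadius_lt_of_forall_lt A hA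
  obtain ⟨r, hr1, hr2⟩ := ENNReal.lt_iff_exists_nnreal_btwn.1 h1
  have h2 := (spectrum.pow_nnnorm_pow_one_div_tendsto_nhds_spectralRadius A).eventually_lt_const hr1
  refine (tendsto_zero_iff_norm_tendsto_zero (f := fun k : ℕ => A ^ k)).2 ?_
  have hr : (r : ℝ) < 1 := by exact_mod_cast hr2
  refine squeeze_zero' (Eventually.of_forall fun _ => norm_nonneg _) ?_
    (tendsto_pow_atTop_nhds_zero_of_lt_one r.2 hr)
  filter_upwards [h2, eventually_gt_atTop 0] with k hk hk0
  have hk' : (0 : ℝ) < k := by exact_mod_cast hk0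
  have := ENNReal.rpow_le_rpow hk.le hk'.le
  rw [← ENNReal.rpow_mul, one_div_mul_cancel hk'.ne', ENNReal.rpow_one, ENNReal.rpow_natCast] at this
  exact_mod_cast this

/-- If all eigenvalues of `P` have positive real part, then `exp (-k P) → 0` as `k → ∞`. -/
lemma tendsto_exp_neg_nat_smul [NeZero n] {P : Matrix (Fin n) (Fin n) ℝ}
    (hP : ∀ z ∈ spectrum ℂ (P.map (algebraMap ℝ ℂ)), 0 < z.re) :
    Tendsto (fun k : ℕ => NormedSpace.exp (-(k : ℝ) • P)) atTop (𝓝 0) := by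
  have hc : Continuous ((algebraMap ℝ ℂ).mapMatrix : Matrix (Fin n) (Fin n) ℝ →+* _) :=
    continuous_id.matrix_map Complex.continuous_ofReal
  have h1 : ∀ z ∈ spectrum ℂ (NormedSpace.exp (-(P.map (algebraMap ℝ ℂ)))), ‖z‖₊ < 1 := by
    intro z hz
    obtain ⟨w, hw, rfl⟩ := exists_mem_spectrum_of_mem_spectrum_exp hz
    have := hP (-w) (by rw [← spectrum.neg_eq] at hw; simpa using hw)
    rw [← NNReal.coe_lt_coe, coe_nnnorm, Complex.norm_exp]
    simpa using this
  have h2 := tendsto_pow_zero_of_spectrum h1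
  have h3 : ∀ k : ℕ, (NormedSpace.exp (-(k : ℝ) • P)).map (algebraMap ℝ ℂ) =
      NormedSpace.exp (-(P.map (algebraMap ℝ ℂ))) ^ k := by
    intro k
    have h := NormedSpace.map_exp (algebraMap ℝ ℂ).mapMatrix hc (-(k : ℝ) • P)
    rw [RingHom.mapMatrix_apply] at h
    refine h.trans ?_
    rw [← Matrix.exp_nsmul]
    congr 1
    ext i j
    simp
  -- The matrices have real entries, so entrywise real parts carry the complex limit back to ℝ.
  have h4 : Tendsto (fun k : ℕ => ((NormedSpace.exp (-(k : ℝ) • P)).map (algebraMap ℝ ℂ)).map Complex.re)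
      atTop (𝓝 ((0 : Matrix (Fin n) (Fin n) ℂ).map Complex.re)) := by
    simp_rw [h3]
    exact ((continuous_id.matrix_map Complex.continuous_re).tendsto _).comp h2
  convert h4 using 2
  · ext i j; simp
  · ext i j; simp

lemma differentiable_det : Differentiable ℝ fun M : Matrix (Fin n) (Fin n) ℝ => M.det := by
  simp_rw [Matrix.det_apply']
  refine Differentiable.fun_sum fun σ _ => ?_
  have h : Differentiable ℝ fun M : Matrix (Fin n) (Fin n) ℝ => ∏ i, M (σ i) i := by
    refine (contDiff_prod (n := 1) fun i _ => ?_).differentiable one_ne_zero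
    exact (Matrix.entryLinearMap ℝ ℝ (σ i) i : Matrix (Fin n) (Fin n) ℝ →ₗ[ℝ]
      ℝ).toContinuousLinearMap.contDiff
  exact h.const_mul _

/-- The curves exp(sP) and 1 + sP agree to first order at s = 0, so by the chain rule their
determinants have the same derivative there, whatever the derivative of det is. For 1 + sP it is
read off the polynomial expansion of the determinant. -/
lemma hasDerivAt_det_exp_smul_zero (P : Matrix (Fin n) (Fin n) ℝ) :
    HasDerivAt (fun s : ℝ => (NormedSpace.exp (s • P)).det) P.trace 0 := by
  have hd : HasFDerivAt (fun M : Matrix (Fin n) (Fin n) ℝ => M.det)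
      (fderiv ℝ (fun M : Matrix (Fin n) (Fin n) ℝ => M.det) 1) 1 :=
    (differentiable_det 1).hasFDerivAt
  have h1 : HasDerivAt (fun s : ℝ => 1 + s • P) P 0 := by
    have h := ((hasDerivAt_id (0 : ℝ)).smul_const P).const_add (1 : Matrix (Fin n) (Fin n) ℝ)
    rw [one_smul] at h
    exact h
  have h2 : HasDerivAt (fun s : ℝ => NormedSpace.exp (s • P)) P 0 := by
    have h := hasDerivAt_exp_smul_const P (0 : ℝ)
    rw [zero_smul, NormedSpace.exp_zero, one_mul] at h
    exact h
  have h3 : HasDerivAt (fun s : ℝ => (1 + s • P).det) P.trace 0 := by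
    have e1 : HasDerivAt (fun s : ℝ => 1 + P.trace * s) (P.trace) 0 := by
      simpa using ((hasDerivAt_id (0 : ℝ)).const_mul P.trace).const_add 1
    have e2 := ((Polynomial.hasDerivAt ((1 + (Polynomial.X : Polynomial ℝ) •
      P.map Polynomial.C).det.divX.divX) (0 : ℝ)).mul (hasDerivAt_pow 2 (0 : ℝ)))
    have e3 := e1.add e2
    refine (e3.congr_deriv (by simp)).congr_of_eventuallyEq (Eventually.of_forall fun s => ?_)
    exact Matrix.det_one_add_smul s P
  have h4 := hd.comp_hasDerivAt_of_eq (0 : ℝ) h1 (by simp)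
  have h5 := hd.comp_hasDerivAt_of_eq (0 : ℝ) h2 (by simp)
  rw [h4.unique h3] at h5
  exact h5

/-- By multiplicativity the derivative at 0 propagates to the equation y' = (tr P) y, so y(s) exp(-s
tr P) is constant. -/
lemma det_exp_smul (P : Matrix (Fin n) (Fin n) ℝ) (s : ℝ) :
    (NormedSpace.exp (s • P)).det = Real.exp (s * P.trace) := by
  have hadd : ∀ a b : ℝ, (NormedSpace.exp ((a + b) • P)).det =
      (NormedSpace.exp (a • P)).det * (NormedSpace.exp (b • P)).det := by
    intro a b
    rw [add_smul, Matrix.exp_add_of_commute _ _ ((Commute.refl P).smul_left a |>.smul_right b),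
      Matrix.det_mul]
  have hder : ∀ s : ℝ, HasDerivAt (fun s : ℝ => (NormedSpace.exp (s • P)).det)
      ((NormedSpace.exp (s • P)).det * P.trace) s := by
    intro s
    have h1 : HasDerivAt (fun u : ℝ => (NormedSpace.exp ((u - s) • P)).det) P.trace s := by
      refine HasDerivAt.comp_sub_const s s (f := fun u : ℝ => (NormedSpace.exp (u • P)).det) ?_
      rw [sub_self]
      exact hasDerivAt_det_exp_smul_zero P
    have h2 := h1.const_mul (NormedSpace.exp (s • P)).det
    refine h2.congr_of_eventuallyEq (Eventually.of_forall fun u => ?_)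
    simp only [← hadd, add_sub_cancel]
  have hconst : ∀ s : ℝ, HasDerivAt
      (fun s : ℝ => (NormedSpace.exp (s • P)).det * Real.exp (-(s * P.trace))) 0 s := by
    intro s
    have h := (hder s).mul ((hasDerivAt_id s).mul_const P.trace).neg.exp
    refine h.congr_deriv ?_
    ring
  have := is_const_of_deriv_eq_zero (fun s => (hconst s).differentiableAt)
    (fun s => (hconst s).deriv) s 0
  simp only [zero_smul, NormedSpace.exp_zero, Matrix.det_one, zero_mul, neg_zero, Real.exp_zero,
    mul_one] at this
  rw [Real.exp_neg] at this
  field_simp at this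
  exact this

lemma continuous_exp_smul_mulVec (P : Matrix (Fin n) (Fin n) ℝ) (x : Fin n → ℝ) :
    Continuous fun s : ℝ => (NormedSpace.exp (s • P)).mulVec x := by
  have : Continuous fun s : ℝ => NormedSpace.exp (s • P) :=
    continuous_iff_continuousAt.2 fun s => (hasDerivAt_exp_smul_const P s).continuousAt
  exact this.matrix_mulVec continuous_const

end MatrixExponential

/-! ### Geometry and volume of ellipsoids. -/

namespace IsParabolicQuasiDist

open Filter Topology

variable {n : ℕ} {P : Matrix (Fin n) (Fin n) ℝ} {ρ : (Fin n → ℝ) → ℝ}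

lemma apply_neg (h : IsParabolicQuasiDist P ρ) (x : Fin n → ℝ) : ρ (-x) = ρ x := by
  simpa using h.sub_comm 0 x

lemma apply_pos (h : IsParabolicQuasiDist P ρ) {x : Fin n → ℝ} (hx : x ≠ 0) : 0 < ρ x :=
  (h.nonneg x).lt_of_ne fun e => hx ((h.eq_zero_iff x).1 e.symm)

lemma exists_one_le_quasi_triangle (h : IsParabolicQuasiDist P ρ) :
    ∃ k : ℝ, 1 ≤ k ∧ ∀ x y z, ρ (x - y) ≤ k * (ρ (x - z) + ρ (y - z)) := by
  obtain ⟨k, hk⟩ := h.quasi_triangle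
  refine ⟨max k 1, le_max_right _ _, fun x y z => (hk x y z).trans ?_⟩
  exact mul_le_mul_of_nonneg_right (le_max_left _ _) (add_nonneg (h.nonneg _) (h.nonneg _))

lemma measurableSet_ellipsoid (h : IsParabolicQuasiDist P ρ) (x : Fin n → ℝ) (r : ℝ) :
    MeasurableSet (ellipsoid ρ x r) :=
  measurableSet_lt (h.measurable.comp (measurable_const.sub measurable_id)) measurable_const

lemma apply_exp_neg_smul (h : IsParabolicQuasiDist P ρ) (s : ℝ) (x : Fin n → ℝ) :
    ρ ((NormedSpace.exp (-s • P)).mulVec x) = Real.exp (-s) * ρ x := by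
  simpa [parabolicDilation] using h.dilation (Real.exp (-s)) (Real.exp_pos _) x

lemma continuous_parabolicDilation (t : ℝ) :
    Continuous (parabolicDilation P t : (Fin n → ℝ) → Fin n → ℝ) :=
  Continuous.matrix_mulVec continuous_const continuous_id

/-- Steinhaus: some sublevel set of ρ has positive measure, so its differences fill a neighbourhood
of 0, and the quasi-triangle inequality bounds ρ on differences. This replaces continuity of ρ,
which is not assumed. -/
lemma exists_bound_nhds_zero (h : IsParabolicQuasiDist P ρ) :
    ∃ N : ℝ, 0 < N ∧ ∀ᶠ x in 𝓝 (0 : Fin n → ℝ), ρ x < N := by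
  obtain ⟨k, hk1, hk⟩ := h.exists_one_le_quasi_triangle
  have hk0 : 0 < k := by linarith
  have hU : ⋃ m : ℕ, {x | ρ x < m} = (univ : Set (Fin n → ℝ)) :=
    eq_univ_of_forall fun x => mem_iUnion.2 (exists_nat_gt (ρ x))
  obtain ⟨m, hm⟩ : ∃ m : ℕ, 0 < volume {x | ρ x < m} := by
    by_contra! hc
    have h0 : volume (⋃ m : ℕ, {x | ρ x < m}) = 0 :=
      measure_iUnion_null fun m => le_antisymm (hc m) zero_le
    rw [hU] at h0
    exact isOpen_univ.measure_ne_zero volume univ_nonempty h0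
  have hm0 : (0 : ℝ) < m := by
    obtain ⟨x, hx⟩ := nonempty_of_measure_ne_zero hm.ne'
    exact (h.nonneg x).trans_lt hx
  refine ⟨k * (m + m), by positivity, ?_⟩
  filter_upwards [Measure.sub_mem_nhds_zero_of_addHaar_pos volume _
    (measurableSet_lt h.measurable measurable_const) hm] with x hx
  obtain ⟨a, ha, b, hb, rfl⟩ := hx
  have := hk a b 0
  simp only [sub_zero] at this
  refine this.trans_lt (mul_lt_mul_of_pos_left (add_lt_add ha hb) hk0)

/-- The dilation by N / r is continuous at 0 and multiplies ρ by N / r, so the bound N becomes the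
bound r. -/
lemma eventually_lt_nhds_zero (h : IsParabolicQuasiDist P ρ) {r : ℝ} (hr : 0 < r) :
    ∀ᶠ x in 𝓝 (0 : Fin n → ℝ), ρ x < r := by
  obtain ⟨N, hN, hb⟩ := h.exists_bound_nhds_zero
  have hc := (continuous_parabolicDilation (P := P) (N / r)).tendsto 0
  have h0 : parabolicDilation P (N / r) 0 = 0 := by simp [parabolicDilation]
  rw [h0] at hc
  filter_upwards [hc.eventually hb] with x hx
  rw [h.dilation _ (by positivity), div_mul_eq_mul_div, div_lt_iff₀ hr] at hx
  exact lt_of_mul_lt_mul_left hx hN.le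

lemma ellipsoid_mem_nhds (h : IsParabolicQuasiDist P ρ) (x : Fin n → ℝ) {r : ℝ} (hr : 0 < r) :
    ellipsoid ρ x r ∈ 𝓝 x := by
  have hc : Tendsto (fun y => x - y) (𝓝 x) (𝓝 0) := by
    simpa using (tendsto_const_nhds (x := x)).sub (tendsto_id (x := 𝓝 x))
  exact hc.eventually (h.eventually_lt_nhds_zero hr)

lemma mem_ellipsoid_self (h : IsParabolicQuasiDist P ρ) (x : Fin n → ℝ) {r : ℝ} (hr : 0 < r) :
    x ∈ ellipsoid ρ x r := mem_of_mem_nhds (h.ellipsoid_mem_nhds x hr)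

lemma _root_.ellipsoid_mono {x : Fin n → ℝ} {r s : ℝ} (hrs : r ≤ s) :
    ellipsoid ρ x r ⊆ ellipsoid ρ x s := fun _ hy => lt_of_lt_of_le hy hrs

lemma exists_subset_ellipsoid (h : IsParabolicQuasiDist P ρ) {K : Set (Fin n → ℝ)}
    (hK : IsCompact K) : ∃ r : ℝ, 0 < r ∧ K ⊆ ellipsoid ρ 0 r := by
  obtain ⟨k, hk1, hk⟩ := h.exists_one_le_quasi_triangle
  have hk0 : 0 < k := by linarith
  refine hK.induction_on (p := fun s => ∃ r : ℝ, 0 < r ∧ s ⊆ ellipsoid ρ 0 r)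
    ⟨1, one_pos, empty_subset _⟩ (fun s t hst ⟨r, hr, ht⟩ => ⟨r, hr, hst.trans ht⟩) ?_ ?_
  · rintro s t ⟨r, hr, hs⟩ ⟨r', hr', ht⟩
    exact ⟨max r r', lt_max_of_lt_left hr, union_subset
      (hs.trans (ellipsoid_mono (le_max_left _ _))) (ht.trans (ellipsoid_mono (le_max_right _ _)))⟩
  · intro x _
    refine ⟨ellipsoid ρ x 1, mem_nhdsWithin_of_mem_nhds (h.ellipsoid_mem_nhds x one_pos),
      k * (ρ x + 1), mul_pos hk0 (by linarith [h.nonneg x]), fun y hy => ?_⟩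
    have h1 := hk 0 y x
    have h2 : ρ (x - y) < 1 := hy
    rw [zero_sub x, h.apply_neg, h.sub_comm y x] at h1
    exact h1.trans_lt (mul_lt_mul_of_pos_left (by linarith) hk0)

/-- Without continuity of ρ a minimum need not be attained, but a local bound suffices for
compactness: on E(x, ρ(x)/(2k)) one has ρ ≥ ρ(x)/(2k), as otherwise the quasi-triangle inequality
would give ρ(x) < ρ(x). -/
lemma exists_le_of_norm_eq_one (h : IsParabolicQuasiDist P ρ) :
    ∃ c : ℝ, 0 < c ∧ ∀ x : Fin n → ℝ, ‖x‖ = 1 → c ≤ ρ x := by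
  obtain ⟨k, hk1, hk⟩ := h.exists_one_le_quasi_triangle
  have hk0 : 0 < k := by linarith
  suffices ∃ c : ℝ, 0 < c ∧ ∀ x ∈ Metric.sphere (0 : Fin n → ℝ) 1, c ≤ ρ x by simpa using this
  refine (isCompact_sphere (0 : Fin n → ℝ) 1).induction_on
    (p := fun s => ∃ c : ℝ, 0 < c ∧ ∀ x ∈ s, c ≤ ρ x)
    ⟨1, one_pos, by simp⟩ (fun s t hst ⟨c, hc, ht⟩ => ⟨c, hc, fun x hx => ht x (hst hx)⟩) ?_ ?_
  · rintro s t ⟨c, hc, hs⟩ ⟨c', hc', ht⟩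
    refine ⟨min c c', lt_min hc hc', ?_⟩
    rintro x (hx | hx)
    · exact (min_le_left _ _).trans (hs x hx)
    · exact (min_le_right _ _).trans (ht x hx)
  · intro x hx
    have hx0 : x ≠ 0 := by rintro rfl; simp at hx
    have hρ := h.apply_pos hx0
    have hr : 0 < ρ x / (2 * k) := by positivity
    refine ⟨_, mem_nhdsWithin_of_mem_nhds (h.ellipsoid_mem_nhds x hr), _, hr, fun y hy => ?_⟩
    have h1 := hk x 0 y
    have h2 : ρ (x - y) < ρ x / (2 * k) := hy
    rw [sub_zero, zero_sub, h.apply_neg] at h1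
    by_contra! h3
    have h4 : k * (ρ (x - y) + ρ y) < k * (ρ x / (2 * k) + ρ x / (2 * k)) :=
      mul_lt_mul_of_pos_left (add_lt_add h2 h3) hk0
    have h5 : k * (ρ x / (2 * k) + ρ x / (2 * k)) = ρ x := by field_simp; ring
    linarith

/-- If ‖x‖ ≥ 1, the orbit exp(-sP)x meets the unit sphere at some s ≥ 0, since it comes arbitrarily
close to 0. There ρ ≥ c, and ρ has only decreased along the way, so ρ(x) ≥ c. -/
lemma exists_sublevel_subset_ball [NeZero n] (h : IsParabolicQuasiDist P ρ)
    (hP : ∀ z ∈ spectrum ℂ (P.map (algebraMap ℝ ℂ)), 0 < z.re) :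
    ∃ c : ℝ, 0 < c ∧ {x | ρ x < c} ⊆ Metric.ball 0 1 := by
  obtain ⟨c, hc, hcx⟩ := h.exists_le_of_norm_eq_one
  refine ⟨c, hc, fun x hx => ?_⟩
  by_contra hx1
  rw [mem_ball_zero_iff, not_lt] at hx1
  have hcont : Continuous fun s : ℝ => ‖(NormedSpace.exp (-s • P)).mulVec x‖ :=
    ((continuous_exp_smul_mulVec P x).comp continuous_neg).norm
  have hlim : Tendsto (fun k : ℕ => ‖(NormedSpace.exp (-(k : ℝ) • P)).mulVec x‖) atTop (𝓝 0) := by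
    have h1 : Continuous fun A : Matrix (Fin n) (Fin n) ℝ => ‖A.mulVec x‖ :=
      (Continuous.matrix_mulVec continuous_id continuous_const).norm
    have h2 := (h1.tendsto 0).comp (tendsto_exp_neg_nat_smul hP)
    rw [Matrix.zero_mulVec, norm_zero] at h2
    exact h2
  obtain ⟨m, hm⟩ := (hlim.eventually_lt_const one_pos).exists
  obtain ⟨s, ⟨hs0, _⟩, hs⟩ := intermediate_value_Icc' (Nat.cast_nonneg m : (0 : ℝ) ≤ m)
    hcont.continuousOn (show (1 : ℝ) ∈ Icc _ _ from ⟨hm.le, by simpa using hx1⟩)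
  have h2 := hcx _ hs
  rw [h.apply_exp_neg_smul] at h2
  have h3 : Real.exp (-s) * ρ x ≤ 1 * ρ x :=
    mul_le_mul_of_nonneg_right (Real.exp_le_one_iff.2 (by linarith)) (h.nonneg x)
  have h4 : ρ x < c := hx
  linarith

/-- The set {ρ < r} is the preimage of {ρ < 1} under the dilation by 1/r, whose determinant is
r^(-γ). -/
lemma volume_sublevel (h : IsParabolicQuasiDist P ρ) {r : ℝ} (hr : 0 < r) :
    volume {x | ρ x < r} = ENNReal.ofReal (r ^ P.trace) * volume {x | ρ x < 1} := by
  have hdet : LinearMap.det (Matrix.toLin' (NormedSpace.exp (Real.log r⁻¹ • P))) =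
      (r ^ P.trace)⁻¹ := by
    rw [LinearMap.det_toLin', det_exp_smul, Real.log_inv, neg_mul, Real.exp_neg,
      Real.rpow_def_of_pos hr]
  have hpos : 0 < r ^ P.trace := Real.rpow_pos_of_pos hr _
  have := Measure.addHaar_preimage_linearMap volume
    (f := Matrix.toLin' (NormedSpace.exp (Real.log r⁻¹ • P)))
    (by rw [hdet]; positivity) {x | ρ x < 1}
  rw [hdet, inv_inv, abs_of_pos hpos] at this
  rw [← this]
  congr 1
  ext x
  have h1 := h.dilation r⁻¹ (by positivity) x
  simp only [parabolicDilation] at h1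
  simp only [mem_ofPred_eq, mem_preimage, Matrix.toLin'_apply, h1]
  rw [inv_mul_lt_iff₀ hr, mul_one]

/-- Ellipsoids of radius `r` have measure `c r ^ γ`, `γ = tr P`. -/
lemma exists_volume_ellipsoid [NeZero n] (h : IsParabolicQuasiDist P ρ)
    (hP : ∀ z ∈ spectrum ℂ (P.map (algebraMap ℝ ℂ)), 0 < z.re) :
    ∃ c : ℝ, 0 < c ∧ ∀ (x : Fin n → ℝ) (r : ℝ), 0 < r →
      volume (ellipsoid ρ x r) = ENNReal.ofReal (c * r ^ P.trace) := by
  have hpos : 0 < volume {x | ρ x < 1} :=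
    Measure.measure_pos_of_mem_nhds volume (h.eventually_lt_nhds_zero one_pos)
  have hfin : volume {x | ρ x < 1} < ∞ := by
    obtain ⟨c, hc, hcb⟩ := h.exists_sublevel_subset_ball hP
    have h1 : volume {x | ρ x < c} < ∞ :=
      (measure_mono hcb).trans_lt Metric.isBounded_ball.measure_lt_top
    -- Only a small sublevel set is known to be bounded; scaling transfers finiteness to radius 1.
    rw [h.volume_sublevel hc] at h1
    by_contra h2
    rw [not_lt, top_le_iff] at h2
    rw [h2, ENNReal.mul_top (by simpa using Real.rpow_pos_of_pos hc _)] at h1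
    exact lt_irrefl _ h1
  refine ⟨(volume {x | ρ x < 1}).toReal, ENNReal.toReal_pos hpos.ne' hfin.ne, fun x r hr => ?_⟩
  have h1 : volume (ellipsoid ρ x r) = volume {x | ρ x < r} :=
    (Measure.measurePreserving_sub_left volume x).measure_preimage
      (measurableSet_lt h.measurable measurable_const).nullMeasurableSet
  rw [h1, h.volume_sublevel hr, mul_comm, ENNReal.ofReal_mul ENNReal.toReal_nonneg,
    ENNReal.ofReal_toReal hfin.ne]

end IsParabolicQuasiDist

/-! ### The Hardy–Littlewood maximal function over ellipsoids. -/

/-- The centred maximal function of `g ≥ 0` over the ellipsoids `E(x, t)`, with the weight `w t` in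
front of the integral over `E(x, t)`. -/
noncomputable def weightedMaximal {n : ℕ} (ρ : (Fin n → ℝ) → ℝ) (w : ℝ → ℝ≥0∞) (g : (Fin n → ℝ) → ℝ≥0∞)
    (x : Fin n → ℝ) : ℝ≥0∞ :=
  ⨆ (t : ℝ) (_ : 0 < t), w t * ∫⁻ y in ellipsoid ρ x t, g y

section LayerCake

/-- Layer-cake formula for a single value. It covers m = ∞, where both sides are infinite, because
maximal functions are not yet known to be finite when it is applied. -/
lemma lintegral_Ioi_indicator_rpow {p : ℝ} (hp : 0 < p) (m : ℝ≥0∞) :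
    ∫⁻ s in Ioi (0 : ℝ), (if ENNReal.ofReal s < m then ENNReal.ofReal (s ^ (p - 1)) else 0) =
      m ^ p / ENNReal.ofReal p := by
  rcases eq_or_ne m ∞ with rfl | hm
  · simp only [ENNReal.ofReal_lt_top, if_true, ENNReal.top_rpow_of_pos hp]
    rw [ENNReal.top_div_of_ne_top ENNReal.ofReal_ne_top]
    by_contra h
    refine not_integrableOn_Ioi_rpow (p - 1) ⟨by fun_prop, ?_⟩
    rw [hasFiniteIntegral_iff_ofReal]
    · exact lt_top_iff_ne_top.2 h
    · filter_upwards [ae_restrict_mem measurableSet_Ioi] with s hs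
      exact Real.rpow_nonneg (le_of_lt hs) _
  · set a := m.toReal with ha
    have ha0 : 0 ≤ a := ENNReal.toReal_nonneg
    have h1 : ∫⁻ s in Ioi (0 : ℝ), (if ENNReal.ofReal s < m then ENNReal.ofReal (s ^ (p - 1)) else 0)
        = ∫⁻ s in Ioo 0 a, ENNReal.ofReal (s ^ (p - 1)) := by
      rw [← lintegral_indicator measurableSet_Ioi, ← lintegral_indicator measurableSet_Ioo]
      congr 1
      ext s
      by_cases hs : 0 < s
      · simp [indicator, hs, ENNReal.ofReal_lt_iff_lt_toReal hs.le hm, ha]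
      · simp [indicator, hs]
    have hint : IntegrableOn (fun s : ℝ => s ^ (p - 1)) (Ioo 0 a) := by
      rw [← integrableOn_Ioc_iff_integrableOn_Ioo,
        ← intervalIntegrable_iff_integrableOn_Ioc_of_le ha0]
      exact intervalIntegral.intervalIntegrable_rpow' (by linarith)
    rw [h1, ← ofReal_integral_eq_lintegral_ofReal hint, ← integral_Ioc_eq_integral_Ioo,
      ← intervalIntegral.integral_of_le ha0, integral_rpow (Or.inl (by linarith)), sub_add_cancel,
      Real.zero_rpow hp.ne', sub_zero, ENNReal.ofReal_div_of_pos hp,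
      ← ENNReal.ofReal_rpow_of_nonneg ha0 hp.le, ha, ENNReal.ofReal_toReal hm]
    filter_upwards [ae_restrict_mem measurableSet_Ioo] with s hs
    exact Real.rpow_nonneg hs.1.le _

lemma lintegral_Ioi_rpow_eq {a : ℝ} (ha : 0 < a) {r : ℝ} (hr : 0 < r) :
    ∫⁻ t in Ioi r, ENNReal.ofReal (t ^ (-a - 1)) = ENNReal.ofReal (a⁻¹ * r ^ (-a)) := by
  rw [← ofReal_integral_eq_lintegral_ofReal (integrableOn_Ioi_rpow_of_lt (by linarith) hr),
    integral_Ioi_rpow_of_lt (by linarith) hr]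
  · congr 1
    rw [sub_add_cancel]
    field_simp
  · filter_upwards [ae_restrict_mem measurableSet_Ioi] with s hs
    exact Real.rpow_nonneg (hr.trans hs).le _

lemma lintegral_Ioc_rpow_eq {a : ℝ} (ha : 0 < a) {r : ℝ} (hr : 0 < r) :
    ∫⁻ t in Ioc 0 r, ENNReal.ofReal (t ^ (a - 1)) = ENNReal.ofReal (a⁻¹ * r ^ a) := by
  have hint : IntegrableOn (fun s : ℝ => s ^ (a - 1)) (Ioc 0 r) := by
    rw [← intervalIntegrable_iff_integrableOn_Ioc_of_le hr.le]
    exact intervalIntegral.intervalIntegrable_rpow' (by linarith)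
  rw [← ofReal_integral_eq_lintegral_ofReal hint, ← intervalIntegral.integral_of_le hr.le,
    integral_rpow (Or.inl (by linarith)), sub_add_cancel, Real.zero_rpow ha.ne', sub_zero,
    div_eq_inv_mul]
  filter_upwards [ae_restrict_mem measurableSet_Ioc] with s hs
  exact Real.rpow_nonneg hs.1.le _

end LayerCake

namespace IsParabolicQuasiDist

open Filter Topology

variable {n : ℕ} {P : Matrix (Fin n) (Fin n) ℝ} {ρ : (Fin n → ℝ) → ℝ}

lemma measurable_lintegral_ellipsoid (h : IsParabolicQuasiDist P ρ) {g : (Fin n → ℝ) → ℝ≥0∞}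
    (hg : Measurable g) (t : ℝ) : Measurable fun x => ∫⁻ y in ellipsoid ρ x t, g y := by
  have hS : MeasurableSet {z : (Fin n → ℝ) × (Fin n → ℝ) | ρ (z.1 - z.2) < t} :=
    measurableSet_lt (h.measurable.comp (measurable_fst.sub measurable_snd)) measurable_const
  have h1 := ((hg.comp measurable_snd).indicator hS).lintegral_prod_right' (ν := volume)
  convert h1 using 2 with x
  rw [← lintegral_indicator (h.measurableSet_ellipsoid x t)]
  rfl

/-- The inequality defining an ellipsoid is strict, so integrals over E(x,t) are suprema over
smaller rational radii. This makes the supremum in the maximal function countable, hence measurable.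
-/
lemma _root_.iUnion_ellipsoid (x : Fin n → ℝ) {t : ℝ} (ht : 0 < t) :
    ⋃ q : {q : ℚ // 0 < (q : ℝ) ∧ (q : ℝ) < t}, ellipsoid ρ x (q : ℚ) = ellipsoid ρ x t := by
  refine subset_antisymm (iUnion_subset fun q => ellipsoid_mono q.2.2.le) fun y hy => ?_
  obtain ⟨q, hq1, hq2⟩ := exists_rat_btwn (max_lt (show ρ (x - y) < t from hy) ht)
  exact mem_iUnion.2 ⟨⟨q, (le_max_right _ _).trans_lt hq1, hq2⟩, (le_max_left _ _).trans_lt hq1⟩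

/-- The supremum may be taken over rational radii when the weight is antitone. -/
lemma _root_.weightedMaximal_eq_iSup_rat {w : ℝ → ℝ≥0∞}
    (hw : AntitoneOn w (Ioi 0)) {g : (Fin n → ℝ) → ℝ≥0∞} (x : Fin n → ℝ) :
    weightedMaximal ρ w g x =
      ⨆ q : {q : ℚ // 0 < (q : ℝ)}, w (q : ℚ) * ∫⁻ y in ellipsoid ρ x (q : ℚ), g y := by
  refine le_antisymm (iSup₂_le fun t ht => ?_) (iSup_le fun q => ?_)
  · have hdir : Directed (· ⊆ ·) fun q : {q : ℚ // 0 < (q : ℝ) ∧ (q : ℝ) < t} =>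
        ellipsoid ρ x (q : ℚ) := by
      refine Monotone.directed_le fun a b hab => ellipsoid_mono ?_
      exact_mod_cast hab
    rw [← iUnion_ellipsoid x ht, setLIntegral_iUnion_of_directed _ hdir, ENNReal.mul_iSup]
    refine iSup_le fun q => ?_
    refine le_trans ?_ (le_iSup _ (⟨q, q.2.1⟩ : {q : ℚ // 0 < (q : ℝ)}))
    gcongr
    exact hw q.2.1 ht q.2.2.le
  · exact le_iSup₂ (f := fun (t : ℝ) (_ : 0 < t) => w t * ∫⁻ y in ellipsoid ρ x t, g y)
      (q : ℝ) q.2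

lemma measurable_weightedMaximal (h : IsParabolicQuasiDist P ρ) {w : ℝ → ℝ≥0∞}
    (hw : AntitoneOn w (Ioi 0)) {g : (Fin n → ℝ) → ℝ≥0∞} (hg : Measurable g) :
    Measurable (weightedMaximal ρ w g) := by
  rw [funext (weightedMaximal_eq_iSup_rat hw)]
  exact Measurable.iSup fun q => (h.measurable_lintegral_ellipsoid hg _).const_mul _

end IsParabolicQuasiDist

/-- The weight `t ↦ (c t ^ γ)⁻¹` of the Hardy–Littlewood maximal function. -/
noncomputable def averageWeight (c γ t : ℝ) : ℝ≥0∞ := (ENNReal.ofReal (c * t ^ γ))⁻¹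

lemma averageWeight_antitoneOn {c γ : ℝ} (hc : 0 < c) (hγ : 0 < γ) :
    AntitoneOn (averageWeight c γ) (Ioi 0) := by
  intro s hs t ht hst
  have hs' : (0 : ℝ) < s := hs
  unfold averageWeight
  gcongr

namespace IsParabolicQuasiDist

open Filter Topology

variable {n : ℕ} {P : Matrix (Fin n) (Fin n) ℝ} {ρ : (Fin n → ℝ) → ℝ}

/-- The weak type (1,1) inequality for the maximal function over ellipsoids. -/
lemma exists_weak_type_one (h : IsParabolicQuasiDist P ρ) (hγ : 0 < P.trace) {c : ℝ} (hc : 0 < c)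
    (hvol : ∀ (x : Fin n → ℝ) (r : ℝ), 0 < r →
      volume (ellipsoid ρ x r) = ENNReal.ofReal (c * r ^ P.trace)) :
    ∃ A : ℝ≥0, ∀ g : (Fin n → ℝ) → ℝ≥0∞, ∀ s : ℝ≥0∞,
      s * volume {x | s < weightedMaximal ρ (averageWeight c P.trace) g x} ≤ A * ∫⁻ y, g y := by
  obtain ⟨k, hk1, hk⟩ := h.exists_one_le_quasi_triangle
  have hk0 : 0 < k := by linarith
  have hA1 : 1 ≤ (3 * k) ^ P.trace := Real.one_le_rpow (by linarith) hγ.le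
  refine ⟨((3 * k) ^ P.trace).toNNReal, fun g s => ?_⟩
  rw [← ENNReal.ofReal]
  -- The covering lemma needs bounded radii. For s > 0 a finite mass of g bounds them, and with
  -- infinite mass there is nothing to prove.
  rcases eq_or_ne (∫⁻ y, g y) ∞ with hg | hg
  · rw [hg, ENNReal.mul_top (by simpa using (by linarith : 0 < (3 * k) ^ P.trace))]
    exact le_top
  rcases eq_or_ne s 0 with rfl | hs0
  · simp
  rcases eq_or_ne s ∞ with rfl | hst
  · simp
  set S := {x | s < weightedMaximal ρ (averageWeight c P.trace) g x}
  have hex : ∀ x ∈ S, ∃ t : ℝ, 0 < t ∧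
      s * volume (ellipsoid ρ x t) ≤ ∫⁻ y in ellipsoid ρ x t, g y := by
    intro x hx
    obtain ⟨t, ht⟩ := lt_iSup_iff.1 (show s < ⨆ (t : ℝ) (_ : 0 < t), _ from hx)
    obtain ⟨ht0, ht⟩ := lt_iSup_iff.1 ht
    refine ⟨t, ht0, ?_⟩
    have hpos : ENNReal.ofReal (c * t ^ P.trace) ≠ 0 := by
      simpa using mul_pos hc (Real.rpow_pos_of_pos ht0 _)
    rw [hvol x t ht0, mul_comm]
    rw [averageWeight, ← ENNReal.div_eq_inv_mul] at ht
    have := (ENNReal.lt_div_iff_mul_lt (Or.inl hpos) (Or.inl ENNReal.ofReal_ne_top)).1 ht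
    rw [mul_comm]; exact this.le
  choose! t ht0 ht using hex
  have htR : ∀ x ∈ S, t x ≤ ((∫⁻ y, g y).toReal / s.toReal / c) ^ (P.trace)⁻¹ := by
    intro x hx
    have hs' : 0 < s.toReal := ENNReal.toReal_pos hs0 hst
    have h1 : s * ENNReal.ofReal (c * t x ^ P.trace) ≤ ∫⁻ y, g y := by
      rw [← hvol x _ (ht0 x hx)]
      exact (ht x hx).trans (setLIntegral_le_lintegral _ _)
    have h2 := ENNReal.toReal_mono hg h1
    have h3 : 0 < t x ^ P.trace := Real.rpow_pos_of_pos (ht0 x hx) _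
    rw [ENNReal.toReal_mul, ENNReal.toReal_ofReal (by positivity)] at h2
    rw [Real.le_rpow_inv_iff_of_pos (ht0 x hx).le (by positivity) hγ, le_div_iff₀ hc,
      le_div_iff₀ hs']
    linarith
  -- Each ellipsoid meets a selected one of at least half its radius, so the quasi-triangle
  -- inequality places its centre in the selected ellipsoid enlarged by k(1 + 2) = 3k.
  obtain ⟨u, huS, hdisj, hcov⟩ := Vitali.exists_disjoint_subfamily_covering_enlargement
    (fun x => ellipsoid ρ x (t x)) S t 2 one_lt_two (fun x hx => (ht0 x hx).le) _ htR
    (fun x hx => ⟨x, h.mem_ellipsoid_self x (ht0 x hx)⟩)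
  -- Ellipsoids need not be open, but each is a neighbourhood of its centre, which suffices for
  -- countability of a disjoint family.
  have hcount : u.Countable := hdisj.countable_of_nonempty_interior fun x hx =>
    ⟨x, mem_interior_iff_mem_nhds.2 (h.ellipsoid_mem_nhds x (ht0 x (huS hx)))⟩
  have hsub : S ⊆ ⋃ b ∈ u, ellipsoid ρ b (3 * k * t b) := by
    intro x hx
    obtain ⟨b, hb, ⟨z, hzx, hzb⟩, hxb⟩ := hcov x hx
    refine mem_iUnion₂.2 ⟨b, hb, ?_⟩
    have h1 : ρ (x - z) < t x := hzx
    have h2 : ρ (b - z) < t b := hzb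
    calc ρ (b - x) ≤ k * (ρ (b - z) + ρ (x - z)) := hk b x z
      _ < k * (t b + 2 * t b) := mul_lt_mul_of_pos_left (by linarith) hk0
      _ = 3 * k * t b := by ring
  have := hcount.to_subtype
  calc s * volume S ≤ s * ∑' b : u, volume (ellipsoid ρ b (3 * k * t b)) := by
        gcongr
        refine (measure_mono hsub).trans ?_
        exact measure_biUnion_le volume hcount _
    _ = ENNReal.ofReal ((3 * k) ^ P.trace) * ∑' b : u, s * volume (ellipsoid ρ b (t b)) := by
        rw [← ENNReal.tsum_mul_left, ← ENNReal.tsum_mul_left]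
        congr 1
        ext b
        have hb := ht0 b (huS b.2)
        rw [hvol _ _ hb, hvol _ _ (by positivity), Real.mul_rpow (by positivity) hb.le,
          mul_left_comm c, ENNReal.ofReal_mul (by positivity)]
        ring
    _ ≤ ENNReal.ofReal ((3 * k) ^ P.trace) * ∑' b : u, ∫⁻ y in ellipsoid ρ b (t b), g y := by
        gcongr with b
        exact ht b (huS b.2)
    _ = ENNReal.ofReal ((3 * k) ^ P.trace) * ∫⁻ y in ⋃ b ∈ u, ellipsoid ρ b (t b), g y := by
        rw [lintegral_biUnion hcount (fun b _ => h.measurableSet_ellipsoid b _) hdisj]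
    _ ≤ _ := by
        gcongr
        exact Measure.restrict_le_self

lemma _root_.weightedMaximal_add_le {w : ℝ → ℝ≥0∞} {g₁ g₂ : (Fin n → ℝ) → ℝ≥0∞} (hg : Measurable g₁)
    (x : Fin n → ℝ) : weightedMaximal ρ w (fun y => g₁ y + g₂ y) x ≤
      weightedMaximal ρ w g₁ x + weightedMaximal ρ w g₂ x := by
  refine iSup₂_le fun t ht => ?_
  rw [lintegral_add_left hg, mul_add]
  exact add_le_add
    (le_iSup₂ (f := fun (t : ℝ) (_ : 0 < t) => w t * ∫⁻ y in ellipsoid ρ x t, g₁ y) t ht)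
    (le_iSup₂ (f := fun (t : ℝ) (_ : 0 < t) => w t * ∫⁻ y in ellipsoid ρ x t, g₂ y) t ht)

lemma _root_.weightedMaximal_mono {w : ℝ → ℝ≥0∞} {g₁ g₂ : (Fin n → ℝ) → ℝ≥0∞} (hg : ∀ y, g₁ y ≤ g₂ y)
    (x : Fin n → ℝ) : weightedMaximal ρ w g₁ x ≤ weightedMaximal ρ w g₂ x :=
  iSup₂_mono fun t _ => mul_le_mul_right (lintegral_mono hg) (w t)

lemma _root_.weightedMaximal_const_le {c : ℝ}
    (hvol : ∀ (x : Fin n → ℝ) (r : ℝ), 0 < r →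
      volume (ellipsoid ρ x r) = ENNReal.ofReal (c * r ^ P.trace)) (a : ℝ≥0∞) (x : Fin n → ℝ) :
    weightedMaximal ρ (averageWeight c P.trace) (fun _ => a) x ≤ a := by
  refine iSup₂_le fun t ht => ?_
  rw [setLIntegral_const, hvol x t ht, averageWeight, mul_left_comm]
  exact mul_le_of_le_one_right' (ENNReal.inv_mul_le_one _)

/-- The strong type (p,p) inequality, `1 < p < ∞`, for the maximal function over ellipsoids. -/
lemma exists_strong_type (h : IsParabolicQuasiDist P ρ) (hγ : 0 < P.trace) {c : ℝ} (hc : 0 < c)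
    (hvol : ∀ (x : Fin n → ℝ) (r : ℝ), 0 < r →
      volume (ellipsoid ρ x r) = ENNReal.ofReal (c * r ^ P.trace)) {p : ℝ} (hp : 1 < p) :
    ∃ A : ℝ≥0, ∀ g : (Fin n → ℝ) → ℝ≥0∞, Measurable g →
      ∫⁻ x, weightedMaximal ρ (averageWeight c P.trace) g x ^ p ≤ A * ∫⁻ y, g y ^ p := by
  obtain ⟨A, hA⟩ := h.exists_weak_type_one hγ hc hvol
  have hp0 : 0 < p := by linarith
  have hp1 : 0 < p - 1 := by linarith
  refine ⟨p.toNNReal * (2 * A) * (2 ^ (p - 1) / (p - 1).toNNReal), fun g hg => ?_⟩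
  set M := weightedMaximal ρ (averageWeight c P.trace) g with hM
  have hMm : Measurable M := h.measurable_weightedMaximal (averageWeight_antitoneOn hc hγ) hg
  have hpt : ∀ s : ℝ, 0 < s → volume {x | ENNReal.ofReal s < M x} ≤
      2 * A * (ENNReal.ofReal s)⁻¹ * ∫⁻ y, if ENNReal.ofReal s < 2 * g y then g y else 0 := by
    intro s hs
    have hs2 : ENNReal.ofReal s = ENNReal.ofReal (s / 2) + ENNReal.ofReal (s / 2) := by
      rw [← ENNReal.ofReal_add (by positivity) (by positivity), add_halves]
    have hs2' : ENNReal.ofReal s = 2 * ENNReal.ofReal (s / 2) := by rw [hs2, two_mul]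
    -- Marcinkiewicz truncation: g ≤ gs + s/2, and averages of the constant s/2 do not exceed it, so
    -- M g > s forces M gs > s/2.
    set gs : (Fin n → ℝ) → ℝ≥0∞ := fun y => if ENNReal.ofReal s < 2 * g y then g y else 0
    have hgs : Measurable gs :=
      Measurable.ite (measurableSet_lt measurable_const (hg.const_mul 2)) hg measurable_const
    have hle : ∀ x, M x ≤ weightedMaximal ρ (averageWeight c P.trace) gs x +
        ENNReal.ofReal (s / 2) := by
      intro x
      refine (weightedMaximal_mono (g₂ := fun y => gs y + ENNReal.ofReal (s / 2)) (fun y => ?_)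
        x).trans ((weightedMaximal_add_le hgs x).trans ?_)
      · by_cases hy : ENNReal.ofReal s < 2 * g y
        · simp [gs, hy]
        · simp only [gs, hy, if_false, zero_add]
          rw [not_lt, hs2'] at hy
          exact (ENNReal.mul_le_mul_iff_right two_ne_zero ENNReal.ofNat_ne_top).1 hy
      · gcongr
        exact weightedMaximal_const_le hvol _ x
    have hsub : {x | ENNReal.ofReal s < M x} ⊆
        {x | ENNReal.ofReal (s / 2) < weightedMaximal ρ (averageWeight c P.trace) gs x} := by
      intro x hx
      have h1 : ENNReal.ofReal s < M x := hx
      rw [hs2] at h1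
      exact lt_of_add_lt_add_right (h1.trans_le (hle x))
    have hw := hA gs (ENNReal.ofReal (s / 2))
    have hs0 : ENNReal.ofReal s ≠ 0 := by simpa using hs
    calc volume {x | ENNReal.ofReal s < M x}
        = (ENNReal.ofReal s)⁻¹ * (ENNReal.ofReal s * volume {x | ENNReal.ofReal s < M x}) := by
          rw [← mul_assoc, ENNReal.inv_mul_cancel hs0 ENNReal.ofReal_ne_top, one_mul]
      _ ≤ (ENNReal.ofReal s)⁻¹ * (2 * (A * ∫⁻ y, gs y)) := by
          have e : ENNReal.ofReal s * volume {x | ENNReal.ofReal s < M x} =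
              2 * (ENNReal.ofReal (s / 2) * volume {x | ENNReal.ofReal s < M x}) := by
            rw [← mul_assoc, ← hs2']
          rw [e]
          gcongr _ * (_ * ?_)
          exact (mul_le_mul_right (measure_mono hsub) _).trans hw
      _ = _ := by ring
  have hm1 : Measurable fun z : (Fin n → ℝ) × ℝ =>
      if ENNReal.ofReal z.2 < M z.1 then ENNReal.ofReal (z.2 ^ (p - 1)) else 0 :=
    Measurable.ite (measurableSet_lt (by fun_prop) (by fun_prop)) (by fun_prop) measurable_const
  have hm2 : Measurable fun z : ℝ × (Fin n → ℝ) =>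
      g z.2 * if ENNReal.ofReal z.1 < 2 * g z.2 then ENNReal.ofReal (z.1 ^ (p - 1 - 1)) else 0 :=
    (hg.comp measurable_snd).mul
      (Measurable.ite (measurableSet_lt (by fun_prop) (by fun_prop)) (by fun_prop) measurable_const)
  have hdiv : ∀ m : ℝ≥0∞, m ^ p = ENNReal.ofReal p * ∫⁻ s in Ioi (0 : ℝ),
      (if ENNReal.ofReal s < m then ENNReal.ofReal (s ^ (p - 1)) else 0) := by
    intro m
    rw [lintegral_Ioi_indicator_rpow hp0, ENNReal.mul_div_cancel (by simpa using hp0)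
      ENNReal.ofReal_ne_top]
  calc ∫⁻ x, M x ^ p
      = ENNReal.ofReal p * ∫⁻ x, ∫⁻ s in Ioi (0 : ℝ),
          (if ENNReal.ofReal s < M x then ENNReal.ofReal (s ^ (p - 1)) else 0) := by
        simp_rw [hdiv]
        rw [lintegral_const_mul' _ _ ENNReal.ofReal_ne_top]
    _ = ENNReal.ofReal p * ∫⁻ s in Ioi (0 : ℝ), ENNReal.ofReal (s ^ (p - 1)) *
          volume {x | ENNReal.ofReal s < M x} := by
        rw [lintegral_lintegral_swap hm1.aemeasurable]
        congr 2
        ext s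
        rw [← lintegral_indicator_const (measurableSet_lt measurable_const hMm)]
        simp [indicator]
    _ ≤ ENNReal.ofReal p * ∫⁻ s in Ioi (0 : ℝ), 2 * A * ∫⁻ y,
          g y * if ENNReal.ofReal s < 2 * g y then ENNReal.ofReal (s ^ (p - 1 - 1)) else 0 := by
        gcongr 1
        refine setLIntegral_mono' measurableSet_Ioi fun s hs => ?_
        have hs0 : (0 : ℝ) < s := hs
        have e : ENNReal.ofReal (s ^ (p - 1)) * (ENNReal.ofReal s)⁻¹ =
            ENNReal.ofReal (s ^ (p - 1 - 1)) := by
          rw [← ENNReal.ofReal_inv_of_pos hs0, ← ENNReal.ofReal_mul (by positivity),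
            Real.rpow_sub_one hs0.ne' (p - 1), div_eq_mul_inv]
        calc ENNReal.ofReal (s ^ (p - 1)) * volume {x | ENNReal.ofReal s < M x}
            ≤ ENNReal.ofReal (s ^ (p - 1)) * (2 * A * (ENNReal.ofReal s)⁻¹ *
                ∫⁻ y, if ENNReal.ofReal s < 2 * g y then g y else 0) := by
              gcongr; exact hpt s hs0
          _ = 2 * A * (ENNReal.ofReal (s ^ (p - 1 - 1)) *
                ∫⁻ y, if ENNReal.ofReal s < 2 * g y then g y else 0) := by
              rw [← e]; ring
          _ = _ := by
              rw [← lintegral_const_mul' _ _ ENNReal.ofReal_ne_top]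
              congr 2
              ext y
              split_ifs <;> simp [mul_comm]
    -- After Tonelli the inner integral is the layer cake of 2g with exponent p - 1; it converges at
    -- 0 because p > 1.
    _ = ENNReal.ofReal p * (2 * A) * ∫⁻ y, g y * ((2 * g y) ^ (p - 1) / ENNReal.ofReal (p - 1)) := by
        rw [lintegral_const_mul' _ _ (by finiteness), lintegral_lintegral_swap hm2.aemeasurable,
          ← mul_assoc]
        congr 1
        refine lintegral_congr fun y => ?_
        rw [lintegral_const_mul _ (Measurable.ite (measurableSet_lt (by fun_prop) (by fun_prop))
          (by fun_prop) measurable_const), lintegral_Ioi_indicator_rpow hp1]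
    _ = _ := by
        have e : ∀ y, g y * ((2 * g y) ^ (p - 1) / ENNReal.ofReal (p - 1)) =
            2 ^ (p - 1) / ENNReal.ofReal (p - 1) * g y ^ p := by
          intro y
          rw [ENNReal.mul_rpow_of_nonneg _ _ hp1.le]
          have : g y ^ p = g y ^ (p - 1) * g y := by
            conv_lhs => rw [← sub_add_cancel p 1, ENNReal.rpow_add_of_nonneg _ _ hp1.le zero_le_one,
              ENNReal.rpow_one]
          rw [this, div_eq_mul_inv, div_eq_mul_inv]
          ring
        have h0 : ENNReal.ofReal (p - 1) ≠ 0 := by simpa using hp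
        have hne : (p - 1).toNNReal ≠ 0 := by simpa using hp
        simp_rw [e]
        rw [lintegral_const_mul' _ _ (ENNReal.div_ne_top (by finiteness) h0), ← mul_assoc]
        push_cast
        rw [ENNReal.coe_div hne, ENNReal.coe_rpow_of_nonneg _ hp1.le]
        rfl

end IsParabolicQuasiDist

/-! ### Balancing the near and far parts of the potential. -/

section Optimization

open Filter Topology

/-- The two terms are equal when r = (N/m)^((q-p)/(αq)), each then being A m^(p/q) N^(1-p/q). As m
or N may vanish, both are first increased by ε, which is then sent to 0. -/
lemma Real.le_mul_rpow_mul_rpow_of_forall_le {k m N A α p q : ℝ} (hp : 0 < p) (hpq : p < q)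
    (hα : 0 < α) (hm : 0 ≤ m) (hN : 0 ≤ N) (hA : 0 ≤ A)
    (hk : ∀ r : ℝ, 0 < r → k ≤ A * r ^ α * m + N * (A * r ^ (-(α * p / (q - p))))) :
    k ≤ 2 * A * (m ^ (p / q) * N ^ (1 - p / q)) := by
  have hq : 0 < q := hp.trans hpq
  have hqp : 0 < q - p := sub_pos.2 hpq
  have ha : 0 < p / q := div_pos hp hq
  have hb : 0 < 1 - p / q := by rw [sub_pos, div_lt_one hq]; exact hpq
  have key : ∀ ε : ℝ, 0 < ε → k ≤ 2 * A * ((m + ε) ^ (p / q) * (N + ε) ^ (1 - p / q)) := by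
    intro ε hε
    have hm' : 0 < m + ε := by linarith
    have hN' : 0 < N + ε := by linarith
    set L := (N + ε) / (m + ε) with hL
    have hL0 : 0 < L := div_pos hN' hm'
    have h1 := hk (L ^ ((q - p) / (α * q))) (Real.rpow_pos_of_pos hL0 _)
    have e1 : (L ^ ((q - p) / (α * q))) ^ α = L ^ (1 - p / q) := by
      rw [← Real.rpow_mul hL0.le]; congr 1; field_simp
    have e2 : (L ^ ((q - p) / (α * q))) ^ (-(α * p / (q - p))) = L ^ (-(p / q)) := by
      rw [← Real.rpow_mul hL0.le]; congr 1; field_simp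
    have e3 : L ^ (1 - p / q) * (m + ε) = (m + ε) ^ (p / q) * (N + ε) ^ (1 - p / q) := by
      rw [hL, Real.div_rpow hN'.le hm'.le, div_mul_eq_mul_div, mul_div_assoc,
        ← Real.rpow_one_sub' hm'.le (by linarith), sub_sub_cancel, mul_comm]
    have e4 : (N + ε) * L ^ (-(p / q)) = (m + ε) ^ (p / q) * (N + ε) ^ (1 - p / q) := by
      rw [hL, Real.rpow_neg hL0.le, Real.div_rpow hN'.le hm'.le, inv_div,
        Real.rpow_sub hN', Real.rpow_one]
      ring
    rw [e1, e2] at h1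
    have h2 : A * L ^ (1 - p / q) * m ≤ A * (L ^ (1 - p / q) * (m + ε)) := by
      rw [mul_assoc]; gcongr; linarith
    have h3 : N * (A * L ^ (-(p / q))) ≤ A * ((N + ε) * L ^ (-(p / q))) := by
      rw [mul_left_comm]; gcongr; linarith
    rw [e3] at h2
    rw [e4] at h3
    linarith
  have hcont : Continuous fun ε : ℝ => 2 * A * ((m + ε) ^ (p / q) * (N + ε) ^ (1 - p / q)) := by
    have h1 := (Real.continuous_rpow_const ha.le).comp
      (continuous_const.add continuous_id : Continuous fun ε : ℝ => m + ε)
    have h2 := (Real.continuous_rpow_const hb.le).comp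
      (continuous_const.add continuous_id : Continuous fun ε : ℝ => N + ε)
    exact continuous_const.mul (h1.mul h2)
  have hlim := (hcont.tendsto 0).mono_left (nhdsWithin_le_nhds (s := Ioi 0))
  simp only [add_zero] at hlim
  exact ge_of_tendsto hlim (by filter_upwards [self_mem_nhdsWithin] with ε hε using key ε hε)

/-- Finiteness of m cannot be dropped: for m = ∞, N = 0 and A > 0 the hypothesis is empty, while the
right side of the conclusion is 0. -/
lemma ENNReal.le_mul_rpow_mul_rpow_of_forall_le {k m N : ℝ≥0∞} {A α p q : ℝ} (hp : 0 < p)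
    (hpq : p < q) (hα : 0 < α) (hm : m ≠ ∞) (hN : N ≠ ∞) (hA : 0 ≤ A)
    (hk : ∀ r : ℝ, 0 < r → k ≤ ENNReal.ofReal (A * r ^ α) * m +
      N * ENNReal.ofReal (A * r ^ (-(α * p / (q - p))))) :
    k ≤ ENNReal.ofReal (2 * A) * (m ^ (p / q) * N ^ (1 - p / q)) := by
  have hq : 0 < q := hp.trans hpq
  have ha : 0 < p / q := div_pos hp hq
  have hb : 0 < 1 - p / q := by rw [sub_pos, div_lt_one hq]; exact hpq
  have hkt : k ≠ ∞ := ne_top_of_le_ne_top (by finiteness) (hk 1 one_pos)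
  have hreal := Real.le_mul_rpow_mul_rpow_of_forall_le (k := k.toReal) (m := m.toReal)
    (N := N.toReal) hp hpq hα ENNReal.toReal_nonneg ENNReal.toReal_nonneg hA fun r hr => by
      have h1 := ENNReal.toReal_mono (by finiteness) (hk r hr)
      rw [ENNReal.toReal_add (by finiteness) (by finiteness), ENNReal.toReal_mul,
        ENNReal.toReal_mul, ENNReal.toReal_ofReal (by positivity),
        ENNReal.toReal_ofReal (by positivity)] at h1
      exact h1
  rw [← ENNReal.ofReal_toReal hkt]
  refine (ENNReal.ofReal_le_ofReal hreal).trans_eq ?_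
  rw [ENNReal.ofReal_mul (p := 2 * A) (by positivity),
    ENNReal.ofReal_mul (p := m.toReal ^ (p / q)) (by positivity),
    ← ENNReal.ofReal_rpow_of_nonneg ENNReal.toReal_nonneg ha.le,
    ← ENNReal.ofReal_rpow_of_nonneg ENNReal.toReal_nonneg hb.le, ENNReal.ofReal_toReal hm,
    ENNReal.ofReal_toReal hN]

end Optimization

/-! ### Hölder on ellipsoids and use of the supremum condition. -/

lemma setLIntegral_le_of_rpow_le {X : Type*} [MeasurableSpace X] {μ : Measure X} {g : X → ℝ≥0∞}
    (hg : Measurable g) {E : Set X} {p V B : ℝ} {N : ℝ≥0∞} (hp : 1 ≤ p) (hV : 0 < V)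
    (hE : μ E = ENNReal.ofReal V) (hB : 0 ≤ B)
    (h : ∫⁻ y in E, g y ^ p ∂μ ≤ N ^ p * ENNReal.ofReal (B * V)) :
    ∫⁻ y in E, g y ∂μ ≤ N * ENNReal.ofReal (B ^ (1 / p) * V) := by
  rcases hp.eq_or_lt with rfl | hp1
  · simpa using h
  have hp0 : 0 < p := by linarith
  have hpq := Real.HolderConjugate.conjExponent hp1
  have h1 := ENNReal.lintegral_mul_le_Lp_mul_Lq (μ.restrict E) hpq hg.aemeasurable
    (aemeasurable_const (b := (1 : ℝ≥0∞)))
  simp only [Pi.mul_apply, mul_one, ENNReal.one_rpow, lintegral_const, one_mul,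
    Measure.restrict_apply_univ] at h1
  refine h1.trans ?_
  rw [hE]
  have hq : 1 / p.conjExponent = 1 - 1 / p := by
    rw [one_div, one_div]; linarith [hpq.inv_add_inv_eq_one]
  -- The factor V^(1/p) from the hypothesis and V^(1-1/p) from Hölder against 1 recombine to V.
  calc (∫⁻ y in E, g y ^ p ∂μ) ^ (1 / p) * ENNReal.ofReal V ^ (1 / p.conjExponent)
      ≤ (N ^ p * ENNReal.ofReal (B * V)) ^ (1 / p) * ENNReal.ofReal V ^ (1 - 1 / p) := by
        rw [hq]; gcongr
    _ = N * ENNReal.ofReal (B ^ (1 / p) * V) := by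
        have hV' : ENNReal.ofReal V ≠ 0 := by simpa using hV
        rw [ENNReal.mul_rpow_of_nonneg _ _ (by positivity), ← ENNReal.rpow_mul,
          mul_one_div_cancel hp0.ne', ENNReal.rpow_one, ENNReal.ofReal_mul hB,
          ENNReal.mul_rpow_of_nonneg _ _ (by positivity), ENNReal.ofReal_mul (by positivity),
          ENNReal.ofReal_rpow_of_nonneg hB (by positivity), mul_assoc, mul_assoc,
          ← ENNReal.rpow_add _ _ hV' ENNReal.ofReal_ne_top, add_sub_cancel, ENNReal.rpow_one]

lemma MorreySupCondition.exists_nonneg {n : ℕ} {γ : ℝ} {φ : (Fin n → ℝ) → ℝ → ℝ}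
    (hφ : MorreySupCondition γ φ) (hpos : ∀ x r, 0 < r → 0 < φ x r) :
    ∃ C : ℝ, 0 ≤ C ∧ ∀ (x : Fin n → ℝ) (r t : ℝ), 0 < r → r < t →
      essInf (fun τ : ℝ => ENNReal.ofReal (φ x τ * τ ^ γ)) (volume.restrict (Ioi t)) ≤
        ENNReal.ofReal (C * φ x r * t ^ γ) := by
  obtain ⟨C, hC⟩ := hφ
  refine ⟨max C 0, le_max_right _ _, fun x r t hr hrt => ?_⟩
  have ht : 0 < t := hr.trans hrt
  have htγ : 0 < t ^ γ := Real.rpow_pos_of_pos ht _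
  have h1 := (le_iSup₂ (f := fun (t : ℝ) (_ : r < t) => ENNReal.ofReal (t ^ (-γ)) *
      essInf (fun τ : ℝ => ENNReal.ofReal (φ x τ * τ ^ γ)) (volume.restrict (Ioi t))) t hrt).trans
    (hC x r hr)
  rw [Real.rpow_neg ht.le, ENNReal.ofReal_inv_of_pos htγ, ← ENNReal.div_eq_inv_mul,
    ENNReal.div_le_iff (by simpa using htγ) ENNReal.ofReal_ne_top] at h1
  refine h1.trans ?_
  rw [← ENNReal.ofReal_mul' htγ.le]
  have := hpos x r hr
  gcongr
  exact le_max_left _ _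

/-- A pointwise-in-radius Morrey bound improves, under the supremum condition, to radii `t > r`
with `φ` evaluated at `r`. -/
lemma setLIntegral_ellipsoid_le_of_morreySupCondition {n : ℕ} {ρ : (Fin n → ℝ) → ℝ} {γ c C : ℝ}
    {φ : (Fin n → ℝ) → ℝ → ℝ} {G : (Fin n → ℝ) → ℝ≥0∞} {D : ℝ≥0∞} (hc : 0 < c) (hD : D ≠ ∞)
    {x : Fin n → ℝ} {r t : ℝ} (hr : 0 < r) (hrt : r < t)
    (hC : essInf (fun τ : ℝ => ENNReal.ofReal (φ x τ * τ ^ γ)) (volume.restrict (Ioi t)) ≤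
        ENNReal.ofReal (C * φ x r * t ^ γ))
    (hG : ∀ τ : ℝ, 0 < τ → ∫⁻ y in ellipsoid ρ x τ, G y ≤
      D * ENNReal.ofReal (φ x τ * (c * τ ^ γ))) :
    ∫⁻ y in ellipsoid ρ x t, G y ≤ D * ENNReal.ofReal (C * φ x r * (c * t ^ γ)) := by
  have ht : 0 < t := hr.trans hrt
  have e : ∀ a b : ℝ, D * ENNReal.ofReal (a * (c * b)) =
      (D * ENNReal.ofReal c) * ENNReal.ofReal (a * b) := by
    intro a b
    rw [mul_left_comm, ENNReal.ofReal_mul hc.le, mul_assoc]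
  rw [e]
  rcases eq_or_ne (D * ENNReal.ofReal c) 0 with h0 | h0
  · have := hG t ht
    rw [e, h0, zero_mul] at this
    rwa [h0, zero_mul]
  have hfin : D * ENNReal.ofReal c ≠ ∞ := by finiteness
  rw [mul_comm, ← ENNReal.div_le_iff h0 hfin]
  -- The integral over E(x,t) is one number, bounded by the integral over every larger E(x,τ).
  -- Hence, divided by D c, it lies below the essential infimum of φ(x,τ) τ^γ over τ > t.
  refine le_trans (le_essInf_of_ae_le _ ?_) hC
  filter_upwards [ae_restrict_mem measurableSet_Ioi] with τ hτ
  have hτ' : t < τ := hτ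
  rw [ENNReal.div_le_iff h0 hfin, mul_comm, ← e]
  exact (lintegral_mono_set (ellipsoid_mono hτ'.le)).trans (hG τ (ht.trans hτ'))

/-! ### The maximal function on Morrey spaces. -/

namespace IsParabolicQuasiDist

variable {n : ℕ} {P : Matrix (Fin n) (Fin n) ℝ} {ρ : (Fin n → ℝ) → ℝ}

/-- Splitting of the maximal function on `E(x₀, r)` into that of the local part of `g` and a
constant that bounds the averages of `g` over large ellipsoids centred at `x₀`. -/
lemma weightedMaximal_le_indicator_add (h : IsParabolicQuasiDist P ρ) {c k : ℝ} (hc : 0 < c)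
    (hk1 : 1 ≤ k) (hk : ∀ x y z, ρ (x - y) ≤ k * (ρ (x - z) + ρ (y - z)))
    {g : (Fin n → ℝ) → ℝ≥0∞} (hg : Measurable g) {x₀ : Fin n → ℝ} {r b : ℝ}
    (hb : 0 ≤ b) {N : ℝ≥0∞}
    (hB : ∀ t : ℝ, r < t → ∫⁻ y in ellipsoid ρ x₀ t, g y ≤
      N * ENNReal.ofReal (b * (c * t ^ P.trace)))
    {y : Fin n → ℝ} (hy : y ∈ ellipsoid ρ x₀ r) :
    weightedMaximal ρ (averageWeight c P.trace) g y ≤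
      weightedMaximal ρ (averageWeight c P.trace)
        ((ellipsoid ρ x₀ (2 * k * r)).indicator g) y +
      N * ENNReal.ofReal ((2 * k) ^ P.trace * b) := by
  have hk0 : 0 < k := by linarith
  have hr : 0 < r := (h.nonneg _).trans_lt hy
  set E := ellipsoid ρ x₀ (2 * k * r)
  have hE : MeasurableSet E := h.measurableSet_ellipsoid _ _
  have hsplit : g = fun z => E.indicator g z + Eᶜ.indicator g z := by
    ext z; by_cases hz : z ∈ E <;> simp [hz]
  conv_lhs => rw [hsplit]
  refine (weightedMaximal_add_le (hg.indicator hE) y).trans ?_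
  gcongr
  refine iSup₂_le fun t ht => ?_
  rw [setLIntegral_indicator hE.compl]
  -- A point z outside E(x₀, 2kr) but in E(y,t) satisfies 2kr ≤ ρ(x₀ - z) < k(r + t). Thus only t >
  -- r contributes, and z lies in E(x₀, 2kt), whose volume exceeds that of E(y,t) by the factor
  -- (2k)^γ.
  have hz : ∀ z ∈ Eᶜ ∩ ellipsoid ρ y t, r < t ∧ z ∈ ellipsoid ρ x₀ (2 * k * t) := by
    rintro z ⟨hzE, hzt⟩
    have h1 : ρ (x₀ - y) < r := hy
    have h2 : ρ (y - z) < t := hzt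
    have h3 : 2 * k * r ≤ ρ (x₀ - z) := not_lt.1 hzE
    have h4 : ρ (x₀ - z) ≤ k * (ρ (x₀ - y) + ρ (y - z)) := by
      rw [h.sub_comm y z]; exact hk x₀ z y
    have h5 : k * (ρ (x₀ - y) + ρ (y - z)) < k * (r + t) :=
      mul_lt_mul_of_pos_left (by linarith) hk0
    have h6 : k * (2 * r) < k * (r + t) := by linarith
    have h7 := lt_of_mul_lt_mul_left h6 hk0.le
    refine ⟨by linarith, ?_⟩
    have h8 : k * (r + t) ≤ k * (2 * t) := mul_le_mul_of_nonneg_left (by linarith) hk0.le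
    change ρ (x₀ - z) < 2 * k * t
    linarith
  by_cases hrt : r < t
  · have htp : 0 < c * t ^ P.trace := mul_pos hc (Real.rpow_pos_of_pos ht _)
    have hrt' : r < 2 * k * t := by nlinarith
    rw [averageWeight, ← ENNReal.div_eq_inv_mul,
      ENNReal.div_le_iff (by simpa using htp) ENNReal.ofReal_ne_top]
    refine (lintegral_mono_set fun z hz' => (hz z hz').2).trans ((hB _ hrt').trans_eq ?_)
    rw [mul_assoc N, ← ENNReal.ofReal_mul (by positivity), Real.mul_rpow (by positivity) ht.le]
    ring_nf
  · have : Eᶜ ∩ ellipsoid ρ y t = ∅ :=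
      eq_empty_of_forall_notMem fun z hz' => hrt (hz z hz').1
    rw [this]
    simp

/-- The maximal function is bounded on the Morrey space when `p > 1`. -/
lemma exists_morrey_strong (h : IsParabolicQuasiDist P ρ) (hγ : 0 < P.trace) {c : ℝ} (hc : 0 < c)
    (hvol : ∀ (x : Fin n → ℝ) (r : ℝ), 0 < r →
      volume (ellipsoid ρ x r) = ENNReal.ofReal (c * r ^ P.trace)) {p : ℝ} (hp : 1 < p)
    {φ : (Fin n → ℝ) → ℝ → ℝ} (hpos : ∀ x r, 0 < r → 0 < φ x r)
    (hφ : MorreySupCondition P.trace φ) :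
    ∃ A : ℝ≥0, ∀ (g : (Fin n → ℝ) → ℝ≥0∞) (N : ℝ≥0∞), Measurable g → N ≠ ∞ →
      (∀ x r, 0 < r → ∫⁻ y in ellipsoid ρ x r, g y ^ p ≤
        N ^ p * ENNReal.ofReal (φ x r * (c * r ^ P.trace))) →
      ∀ x r, 0 < r →
        ∫⁻ y in ellipsoid ρ x r, weightedMaximal ρ (averageWeight c P.trace) g y ^ p ≤
          A * (N ^ p * ENNReal.ofReal (φ x r * (c * r ^ P.trace))) := by
  obtain ⟨k, hk1, hk⟩ := h.exists_one_le_quasi_triangle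
  obtain ⟨A, hA⟩ := h.exists_strong_type hγ hc hvol hp
  obtain ⟨C, hC0, hC⟩ := hφ.exists_nonneg hpos
  have hk0 : 0 < k := by linarith
  have hp0 : 0 < p := by linarith
  -- The factor 2^(p-1) comes from (a + b)^p ≤ 2^(p-1)(a^p + b^p); the two summands come from the
  -- local part on E(x, 2kr) and from the constant b.
  refine ⟨2 ^ (p - 1) * (A * (C * (2 * k) ^ P.trace).toNNReal +
    (((2 * k) ^ P.trace) ^ p * C).toNNReal), fun g N hg hN hM x r hr => ?_⟩
  have hφ0 := hpos x r hr
  have hrγ : 0 < r ^ P.trace := Real.rpow_pos_of_pos hr _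
  have hsup : ∀ t, r < t → ∫⁻ y in ellipsoid ρ x t, g y ^ p ≤
      N ^ p * ENNReal.ofReal (C * φ x r * (c * t ^ P.trace)) := fun t hrt =>
    setLIntegral_ellipsoid_le_of_morreySupCondition hc (by finiteness) hr hrt (hC x r t hr hrt)
      fun τ hτ => hM x τ hτ
  have hB : ∀ t, r < t → ∫⁻ y in ellipsoid ρ x t, g y ≤
      N * ENNReal.ofReal ((C * φ x r) ^ (1 / p) * (c * t ^ P.trace)) := fun t hrt =>
    setLIntegral_le_of_rpow_le hg hp.le (mul_pos hc (Real.rpow_pos_of_pos (hr.trans hrt) _))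
      (hvol x t (hr.trans hrt)) (by positivity) (hsup t hrt)
  set E := ellipsoid ρ x (2 * k * r)
  have hE : MeasurableSet E := h.measurableSet_ellipsoid _ _
  set M₁ := weightedMaximal ρ (averageWeight c P.trace) (E.indicator g)
  have hM₁ : Measurable M₁ :=
    h.measurable_weightedMaximal (averageWeight_antitoneOn hc hγ) (hg.indicator hE)
  set b := N * ENNReal.ofReal ((2 * k) ^ P.trace * (C * φ x r) ^ (1 / p))
  have hloc : ∫⁻ y, M₁ y ^ p ≤ A * (N ^ p * ENNReal.ofReal (C * φ x r * (c * (2 * k * r) ^ P.trace))) := by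
    refine (hA _ (hg.indicator hE)).trans ?_
    gcongr
    refine le_trans (le_of_eq ?_) (hsup (2 * k * r) (by nlinarith))
    rw [← lintegral_indicator hE]
    congr 1
    ext y
    by_cases hy : y ∈ E <;> simp [hy, hp0]
  calc ∫⁻ y in ellipsoid ρ x r, weightedMaximal ρ (averageWeight c P.trace) g y ^ p
      ≤ ∫⁻ y in ellipsoid ρ x r, 2 ^ (p - 1) * (M₁ y ^ p + b ^ p) := by
        refine setLIntegral_mono' (h.measurableSet_ellipsoid _ _) fun y hy => ?_
        refine le_trans ?_ (ENNReal.rpow_add_le_mul_rpow_add_rpow _ _ hp.le)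
        gcongr
        exact h.weightedMaximal_le_indicator_add hc hk1 hk hg (by positivity) hB hy
    _ = 2 ^ (p - 1) * ((∫⁻ y in ellipsoid ρ x r, M₁ y ^ p) +
          b ^ p * ENNReal.ofReal (c * r ^ P.trace)) := by
        rw [lintegral_const_mul' _ _ (by finiteness), lintegral_add_right _ measurable_const,
          setLIntegral_const, hvol x r hr]
    _ ≤ 2 ^ (p - 1) * (A * (N ^ p * ENNReal.ofReal (C * φ x r * (c * (2 * k * r) ^ P.trace))) +
          b ^ p * ENNReal.ofReal (c * r ^ P.trace)) := by
        gcongr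
        exact (setLIntegral_le_lintegral _ _).trans hloc
    _ = _ := by
        have e1 : ENNReal.ofReal (C * φ x r * (c * (2 * k * r) ^ P.trace)) =
            ENNReal.ofReal (C * (2 * k) ^ P.trace) *
              ENNReal.ofReal (φ x r * (c * r ^ P.trace)) := by
          rw [← ENNReal.ofReal_mul (by positivity), Real.mul_rpow (by positivity) hr.le]
          ring_nf
        have e2 : b ^ p * ENNReal.ofReal (c * r ^ P.trace) =
            ENNReal.ofReal (((2 * k) ^ P.trace) ^ p * C) *
              (N ^ p * ENNReal.ofReal (φ x r * (c * r ^ P.trace))) := by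
          rw [ENNReal.mul_rpow_of_nonneg _ _ hp0.le,
            ENNReal.ofReal_rpow_of_nonneg (by positivity) hp0.le,
            Real.mul_rpow (by positivity) (by positivity), ← Real.rpow_mul (by positivity : 0 ≤ C * φ x r),
            one_div_mul_cancel hp0.ne', Real.rpow_one, mul_assoc, mul_left_comm _ (N ^ p),
            ← ENNReal.ofReal_mul (by positivity), ← ENNReal.ofReal_mul (by positivity)]
          ring_nf
        rw [e1, e2]
        push_cast
        rw [ENNReal.coe_rpow_of_nonneg _ (by linarith)]
        simp only [ENNReal.ofReal]
        push_cast
        ring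

/-- The maximal function is of weak type on the Morrey space when `p = 1`. -/
lemma exists_morrey_weak (h : IsParabolicQuasiDist P ρ) (hγ : 0 < P.trace) {c : ℝ} (hc : 0 < c)
    (hvol : ∀ (x : Fin n → ℝ) (r : ℝ), 0 < r →
      volume (ellipsoid ρ x r) = ENNReal.ofReal (c * r ^ P.trace))
    {φ : (Fin n → ℝ) → ℝ → ℝ} (hpos : ∀ x r, 0 < r → 0 < φ x r)
    (hφ : MorreySupCondition P.trace φ) :
    ∃ A : ℝ≥0, ∀ (g : (Fin n → ℝ) → ℝ≥0∞) (N : ℝ≥0∞), Measurable g → N ≠ ∞ →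
      (∀ x r, 0 < r → ∫⁻ y in ellipsoid ρ x r, g y ≤
        N * ENNReal.ofReal (φ x r * (c * r ^ P.trace))) →
      ∀ x r, 0 < r → ∀ s : ℝ≥0∞,
        s * volume {y | y ∈ ellipsoid ρ x r ∧
          s < weightedMaximal ρ (averageWeight c P.trace) g y} ≤
          A * (N * ENNReal.ofReal (φ x r * (c * r ^ P.trace))) := by
  obtain ⟨k, hk1, hk⟩ := h.exists_one_le_quasi_triangle
  obtain ⟨A, hA⟩ := h.exists_weak_type_one hγ hc hvol
  obtain ⟨C, hC0, hC⟩ := hφ.exists_nonneg hpos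
  have hk0 : 0 < k := by linarith
  refine ⟨2 * ((A + 1) * (C * (2 * k) ^ P.trace).toNNReal), fun g N hg hN hM x r hr s => ?_⟩
  have hφ0 := hpos x r hr
  have hrγ : 0 < r ^ P.trace := Real.rpow_pos_of_pos hr _
  have hB : ∀ t, r < t → ∫⁻ y in ellipsoid ρ x t, g y ≤
      N * ENNReal.ofReal (C * φ x r * (c * t ^ P.trace)) := fun t hrt =>
    setLIntegral_ellipsoid_le_of_morreySupCondition hc hN hr hrt (hC x r t hr hrt)
      fun τ hτ => hM x τ hτ
  set E := ellipsoid ρ x (2 * k * r)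
  have hE : MeasurableSet E := h.measurableSet_ellipsoid _ _
  set M₁ := weightedMaximal ρ (averageWeight c P.trace) (E.indicator g)
  set b := N * ENNReal.ofReal ((2 * k) ^ P.trace * (C * φ x r)) with hbdef
  set W := N * ENNReal.ofReal (φ x r * (c * r ^ P.trace)) with hW
  have e1 : b * ENNReal.ofReal (c * r ^ P.trace) =
      ENNReal.ofReal (C * (2 * k) ^ P.trace) * W := by
    rw [hbdef, hW, mul_assoc, mul_left_comm _ N, ← ENNReal.ofReal_mul (by positivity),
      ← ENNReal.ofReal_mul (by positivity)]
    ring_nf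
  have hloc : s / 2 * volume {y | s / 2 < M₁ y} ≤ A * (ENNReal.ofReal (C * (2 * k) ^ P.trace) * W) := by
    refine (hA _ _).trans ?_
    gcongr
    rw [lintegral_indicator hE]
    refine (hB (2 * k * r) (by nlinarith)).trans_eq ?_
    rw [hW, mul_left_comm _ N, ← ENNReal.ofReal_mul (by positivity),
      Real.mul_rpow (by positivity) hr.le]
    ring_nf
  -- If a sum exceeds s, one summand exceeds s/2; the second summand is constant, so its level set
  -- is all of E(x,r) or empty.
  have hsub : {y | y ∈ ellipsoid ρ x r ∧ s < weightedMaximal ρ (averageWeight c P.trace) g y} ⊆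
      {y | s / 2 < M₁ y} ∪ {y | y ∈ ellipsoid ρ x r ∧ s / 2 < b} := by
    rintro y ⟨hy, hys⟩
    by_contra hcon
    simp only [mem_union, mem_ofPred_eq, not_or, not_and, not_lt] at hcon
    have h1 := h.weightedMaximal_le_indicator_add hc hk1 hk hg (by positivity) hB hy
    have h2 := h1.trans (add_le_add hcon.1 (hcon.2 hy))
    rw [ENNReal.add_halves] at h2
    exact absurd hys (not_lt.2 h2)
  have hfar : s / 2 * volume {y | y ∈ ellipsoid ρ x r ∧ s / 2 < b} ≤
      ENNReal.ofReal (C * (2 * k) ^ P.trace) * W := by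
    rw [← e1]
    by_cases hs : s / 2 < b
    · simp only [hs, and_true]
      rw [← hvol x r hr]
      gcongr
      rfl
    · simp [hs]
  calc s * volume {y | y ∈ ellipsoid ρ x r ∧ s < weightedMaximal ρ (averageWeight c P.trace) g y}
      ≤ s * (volume {y | s / 2 < M₁ y} + volume {y | y ∈ ellipsoid ρ x r ∧ s / 2 < b}) := by
        gcongr
        exact (measure_mono hsub).trans (measure_union_le _ _)
    _ = 2 * (s / 2 * volume {y | s / 2 < M₁ y} +
          s / 2 * volume {y | y ∈ ellipsoid ρ x r ∧ s / 2 < b}) := by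
        rw [← mul_add, ← mul_assoc, ENNReal.mul_div_cancel two_ne_zero ENNReal.ofNat_ne_top]
    _ ≤ 2 * (A * (ENNReal.ofReal (C * (2 * k) ^ P.trace) * W) +
          ENNReal.ofReal (C * (2 * k) ^ P.trace) * W) := by gcongr
    _ = _ := by
        simp only [ENNReal.ofReal]
        push_cast
        ring

end IsParabolicQuasiDist

/-! ### The potential: domination of the kernel and Hedberg's splitting. -/

/-- The superposition `∫₀^∞ t ^ (-β - 1) ∫_{E(x, t)} g dt`, which is comparable to the fractional
integral with kernel `ρ(x - y) ^ (-β)` and dominates the fractional maximal function. -/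
noncomputable def ellipsoidPotential {n : ℕ} (ρ : (Fin n → ℝ) → ℝ) (β : ℝ)
    (g : (Fin n → ℝ) → ℝ≥0∞) (x : Fin n → ℝ) : ℝ≥0∞ :=
  ∫⁻ t in Ioi (0 : ℝ), ENNReal.ofReal (t ^ (-β - 1)) * ∫⁻ y in ellipsoid ρ x t, g y

/-- The factor t^(-β) equals β ∫_t^∞ s^(-β-1) ds, and for s > t the integral over E(x,s) is at least
that over E(x,t). This is what makes the potential control the fractional maximal function. -/
lemma rpow_mul_setLIntegral_le_ellipsoidPotential {n : ℕ} {ρ : (Fin n → ℝ) → ℝ} {β : ℝ}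
    (hβ : 0 < β) (g : (Fin n → ℝ) → ℝ≥0∞) (x : Fin n → ℝ) {t : ℝ} (ht : 0 < t) :
    ENNReal.ofReal (t ^ (-β)) * ∫⁻ y in ellipsoid ρ x t, g y ≤
      ENNReal.ofReal β * ellipsoidPotential ρ β g x := by
  have e : ENNReal.ofReal (t ^ (-β)) =
      ENNReal.ofReal β * ∫⁻ s in Ioi t, ENNReal.ofReal (s ^ (-β - 1)) := by
    rw [lintegral_Ioi_rpow_eq hβ ht, ← ENNReal.ofReal_mul hβ.le, mul_inv_cancel_left₀ hβ.ne']
  rw [e, mul_assoc]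
  gcongr
  rw [← lintegral_mul_const _ (by fun_prop)]
  refine (setLIntegral_mono' measurableSet_Ioi fun s hs => ?_).trans
    (lintegral_mono_set (Ioi_subset_Ioi ht.le))
  gcongr
  exact ellipsoid_mono (le_of_lt hs)

lemma MorreyIntegralCondition.exists_nonneg {n : ℕ} {α p q : ℝ} {φ : (Fin n → ℝ) → ℝ → ℝ}
    (hφ : MorreyIntegralCondition α p q φ) :
    ∃ C : ℝ, 0 ≤ C ∧ ∀ (x : Fin n → ℝ) (r : ℝ), 0 < r →
      ∫⁻ t in Ioi r, ENNReal.ofReal (t ^ α * φ x t ^ (1 / p) / t) ≤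
        ENNReal.ofReal (C * r ^ (-(α * p / (q - p)))) := by
  obtain ⟨C, hC⟩ := hφ
  refine ⟨max C 0, le_max_right _ _, fun x r hr => (hC x r hr).trans ?_⟩
  gcongr
  exact le_max_left _ _

namespace IsParabolicQuasiDist

variable {n : ℕ} {P : Matrix (Fin n) (Fin n) ℝ} {ρ : (Fin n → ℝ) → ℝ}

/-- Write ρ^(-β) as β ∫_ρ^∞ t^(-β-1) dt and exchange the integrals. -/
lemma lintegral_kernel_le_ellipsoidPotential (h : IsParabolicQuasiDist P ρ) {β : ℝ} (hβ : 0 < β)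
    {g : (Fin n → ℝ) → ℝ≥0∞} (hg : Measurable g) (x : Fin n → ℝ) :
    ∫⁻ y, ENNReal.ofReal ((ρ (x - y) ^ β)⁻¹) * g y ≤
      ENNReal.ofReal β * ellipsoidPotential ρ β g x := by
  have hm : Measurable fun z : (Fin n → ℝ) × ℝ =>
      if ρ (x - z.1) < z.2 then ENNReal.ofReal (z.2 ^ (-β - 1)) * g z.1 else 0 :=
    Measurable.ite (measurableSet_lt
      (h.measurable.comp (measurable_const.sub measurable_fst)) measurable_snd)
      ((by fun_prop : Measurable fun z : (Fin n → ℝ) × ℝ => ENNReal.ofReal (z.2 ^ (-β - 1))).mul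
        (hg.comp measurable_fst)) measurable_const
  have hker : ∀ y, ENNReal.ofReal ((ρ (x - y) ^ β)⁻¹) * g y ≤ ENNReal.ofReal β *
      ∫⁻ t in Ioi (0 : ℝ),
        if ρ (x - y) < t then ENNReal.ofReal (t ^ (-β - 1)) * g y else 0 := by
    intro y
    -- On the diagonal the kernel is (0^β)⁻¹ = 0 by convention, so the bound is trivial there.
    rcases (h.nonneg (x - y)).eq_or_lt with h0 | h0
    · simp [← h0, Real.zero_rpow hβ.ne']
    · have e : ∫⁻ t in Ioi (0 : ℝ),
          (if ρ (x - y) < t then ENNReal.ofReal (t ^ (-β - 1)) * g y else 0) =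
          ENNReal.ofReal (β⁻¹ * ρ (x - y) ^ (-β)) * g y := by
        rw [← lintegral_Ioi_rpow_eq hβ h0, ← lintegral_mul_const _ (by fun_prop),
          ← lintegral_indicator measurableSet_Ioi, ← lintegral_indicator measurableSet_Ioi]
        refine lintegral_congr fun t => ?_
        by_cases ht : ρ (x - y) < t
        · simp [indicator, ht, h0.trans ht]
        · simp [indicator, ht]
      rw [e, ← mul_assoc, ← ENNReal.ofReal_mul hβ.le, mul_inv_cancel_left₀ hβ.ne',
        Real.rpow_neg h0.le]
  calc ∫⁻ y, ENNReal.ofReal ((ρ (x - y) ^ β)⁻¹) * g y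
      ≤ ∫⁻ y, ENNReal.ofReal β * ∫⁻ t in Ioi (0 : ℝ),
          if ρ (x - y) < t then ENNReal.ofReal (t ^ (-β - 1)) * g y else 0 := lintegral_mono hker
    _ = ENNReal.ofReal β * ∫⁻ t in Ioi (0 : ℝ), ∫⁻ y,
          if ρ (x - y) < t then ENNReal.ofReal (t ^ (-β - 1)) * g y else 0 := by
        rw [lintegral_const_mul' _ _ ENNReal.ofReal_ne_top, lintegral_lintegral_swap hm.aemeasurable]
    _ = _ := by
        rw [ellipsoidPotential]
        congr 1
        refine lintegral_congr fun t => ?_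
        rw [← lintegral_const_mul' _ _ ENNReal.ofReal_ne_top,
          ← lintegral_indicator (h.measurableSet_ellipsoid x t)]
        refine lintegral_congr fun y => ?_
        by_cases hy : ρ (x - y) < t <;> simp [indicator, ellipsoid, hy]

/-- Hedberg's splitting of the potential at radius `r`. -/
lemma _root_.exists_ellipsoidPotential_le {c : ℝ} (hc : 0 < c)
    (hvol : ∀ (x : Fin n → ℝ) (r : ℝ), 0 < r →
      volume (ellipsoid ρ x r) = ENNReal.ofReal (c * r ^ P.trace)) {p q α : ℝ} (hp : 1 ≤ p)
    (hα : 0 < α)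
    {φ : (Fin n → ℝ) → ℝ → ℝ} (hpos : ∀ x r, 0 < r → 0 < φ x r)
    (hφ : MorreyIntegralCondition α p q φ) :
    ∃ A : ℝ, 0 ≤ A ∧ ∀ (g : (Fin n → ℝ) → ℝ≥0∞) (N : ℝ≥0∞), Measurable g → N ≠ ∞ →
      (∀ x r, 0 < r → ∫⁻ y in ellipsoid ρ x r, g y ^ p ≤
        N ^ p * ENNReal.ofReal (φ x r * (c * r ^ P.trace))) →
      ∀ x r, 0 < r → ellipsoidPotential ρ (P.trace - α) g x ≤
        ENNReal.ofReal (A * r ^ α) * weightedMaximal ρ (averageWeight c P.trace) g x +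
          N * ENNReal.ofReal (A * r ^ (-(α * p / (q - p)))) := by
  obtain ⟨C, hC0, hC⟩ := hφ.exists_nonneg
  refine ⟨c * α⁻¹ + c * C, by positivity, fun g N hg hN hM x r hr => ?_⟩
  set M := weightedMaximal ρ (averageWeight c P.trace) g x with hMdef
  have hnear : ∀ t, 0 < t → ∫⁻ y in ellipsoid ρ x t, g y ≤ ENNReal.ofReal (c * t ^ P.trace) * M := by
    intro t ht
    have htp : 0 < c * t ^ P.trace := mul_pos hc (Real.rpow_pos_of_pos ht _)
    have h1 : averageWeight c P.trace t * ∫⁻ y in ellipsoid ρ x t, g y ≤ M :=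
      le_iSup₂ (f := fun (t : ℝ) (_ : 0 < t) =>
        averageWeight c P.trace t * ∫⁻ y in ellipsoid ρ x t, g y) t ht
    rwa [averageWeight, ← ENNReal.div_eq_inv_mul,
      ENNReal.div_le_iff (by simpa using htp) ENNReal.ofReal_ne_top, mul_comm] at h1
  have hfar : ∀ t, 0 < t → ∫⁻ y in ellipsoid ρ x t, g y ≤
      N * ENNReal.ofReal (φ x t ^ (1 / p) * (c * t ^ P.trace)) := fun t ht =>
    setLIntegral_le_of_rpow_le hg hp (mul_pos hc (Real.rpow_pos_of_pos ht _)) (hvol x t ht)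
      (hpos x t ht).le (hM x t ht)
  have hpow : ∀ t : ℝ, 0 < t → t ^ (-(P.trace - α) - 1) * t ^ P.trace = t ^ (α - 1) := by
    intro t ht
    rw [← Real.rpow_add ht]
    ring_nf
  rw [ellipsoidPotential, ← Ioc_union_Ioi_eq_Ioi hr.le,
    lintegral_union measurableSet_Ioi (Ioc_disjoint_Ioi le_rfl)]
  refine add_le_add ?_ ?_
  -- Near part: averages are at most M, leaving the integral of t^(α-1), which converges at 0 since
  -- α > 0.
  · calc ∫⁻ t in Ioc 0 r, ENNReal.ofReal (t ^ (-(P.trace - α) - 1)) * ∫⁻ y in ellipsoid ρ x t, g y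
        ≤ ∫⁻ t in Ioc 0 r, ENNReal.ofReal (t ^ (α - 1)) * (ENNReal.ofReal c * M) := by
          refine setLIntegral_mono' measurableSet_Ioc fun t ht => ?_
          refine (mul_le_mul_right (hnear t ht.1) _).trans_eq ?_
          have := Real.rpow_pos_of_pos ht.1 (-(P.trace - α) - 1)
          rw [← hpow t ht.1, ENNReal.ofReal_mul hc.le, ENNReal.ofReal_mul this.le]
          ring
      _ = ENNReal.ofReal (c * α⁻¹ * r ^ α) * M := by
          rw [lintegral_mul_const _ (by fun_prop), lintegral_Ioc_rpow_eq hα hr, ← mul_assoc,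
            ← ENNReal.ofReal_mul (by positivity)]
          ring_nf
      _ ≤ _ := by
          gcongr
          linarith [mul_nonneg hc.le hC0]
  -- Far part: the Morrey bound turns the integrand into that of the integral condition.
  · calc ∫⁻ t in Ioi r, ENNReal.ofReal (t ^ (-(P.trace - α) - 1)) * ∫⁻ y in ellipsoid ρ x t, g y
        ≤ ∫⁻ t in Ioi r, (N * ENNReal.ofReal c) * ENNReal.ofReal (t ^ α * φ x t ^ (1 / p) / t) := by
          refine setLIntegral_mono' measurableSet_Ioi fun t ht => ?_
          have ht0 : 0 < t := hr.trans ht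
          refine (mul_le_mul_right (hfar t ht0) _).trans_eq ?_
          have := Real.rpow_pos_of_pos ht0 (-(P.trace - α) - 1)
          have hφt := (hpos x t ht0).le
          rw [mul_left_comm, mul_assoc N, ← ENNReal.ofReal_mul this.le, ← ENNReal.ofReal_mul hc.le]
          congr 2
          rw [show t ^ α * φ x t ^ (1 / p) / t = t ^ (α - 1) * φ x t ^ (1 / p) by
            rw [Real.rpow_sub_one ht0.ne']; ring, ← hpow t ht0]
          ring
      _ ≤ N * ENNReal.ofReal (c * C * r ^ (-(α * p / (q - p)))) := by
          rw [lintegral_const_mul' _ _ (by finiteness), mul_assoc N, mul_assoc c,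
            ENNReal.ofReal_mul hc.le]
          gcongr
          exact hC x r hr
      _ ≤ _ := by
          gcongr
          linarith [mul_nonneg hc.le (inv_nonneg.2 hα.le)]

end IsParabolicQuasiDist

/-! ### Adams-type estimates for the potential. -/

namespace IsParabolicQuasiDist

open Filter Topology

variable {n : ℕ} {P : Matrix (Fin n) (Fin n) ℝ} {ρ : (Fin n → ℝ) → ℝ}

lemma _root_.ae_of_forall_ae_restrict_ellipsoid {p : (Fin n → ℝ) → Prop}
    (h : ∀ r : ℝ, 0 < r → ∀ᵐ x ∂volume.restrict (ellipsoid ρ 0 r), p x) :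
    ∀ᵐ x, p x := by
  have hU : ⋃ m : ℕ, ellipsoid ρ 0 ((m : ℝ) + 1) = univ := eq_univ_of_forall fun x => by
    obtain ⟨m, hm⟩ := exists_nat_gt (ρ (0 - x))
    exact mem_iUnion.2 ⟨m, show ρ (0 - x) < m + 1 by linarith⟩
  rw [← Measure.restrict_univ (μ := (volume : Measure (Fin n → ℝ))), ← hU,
    ae_restrict_iUnion_iff]
  exact fun m => h _ (by positivity)

lemma _root_.ENNReal.mul_rpow_div_mul_rpow_one_sub_rpow (a m N : ℝ≥0∞) {p q : ℝ} (hp : 0 < p)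
    (hpq : p < q) : (a * (m ^ (p / q) * N ^ (1 - p / q))) ^ q = a ^ q * N ^ (q - p) * m ^ p := by
  have hq : 0 < q := hp.trans hpq
  rw [ENNReal.mul_rpow_of_nonneg _ _ hq.le, ENNReal.mul_rpow_of_nonneg _ _ hq.le,
    ← ENNReal.rpow_mul, ← ENNReal.rpow_mul, div_mul_cancel₀ _ hq.ne', sub_mul, one_mul,
    div_mul_cancel₀ _ hq.ne']
  ring

lemma _root_.ENNReal.coe_mul_rpow_mul_rpow (A B : ℝ≥0) (N : ℝ≥0∞) {p q : ℝ} (hp : 0 < p) (hpq : p < q) :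
    ((A * B ^ (1 / q) : ℝ≥0) * N : ℝ≥0∞) ^ q = (A : ℝ≥0∞) ^ q * N ^ (q - p) * (B * N ^ p) := by
  have hq : 0 < q := hp.trans hpq
  have hN : N ^ q = N ^ (q - p) * N ^ p := by
    rw [← ENNReal.rpow_add_of_nonneg _ _ (by linarith) hp.le, sub_add_cancel]
  push_cast
  rw [ENNReal.coe_rpow_of_nonneg _ (by positivity), ENNReal.mul_rpow_of_nonneg _ _ hq.le,
    ENNReal.mul_rpow_of_nonneg _ _ hq.le, ← ENNReal.rpow_mul, one_div_mul_cancel hq.ne',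
    ENNReal.rpow_one, hN]
  ring

/-- Adams-type estimate for the potential, `p > 1`. -/
lemma exists_potential_strong (h : IsParabolicQuasiDist P ρ) (hγ : 0 < P.trace) {c : ℝ}
    (hc : 0 < c)
    (hvol : ∀ (x : Fin n → ℝ) (r : ℝ), 0 < r →
      volume (ellipsoid ρ x r) = ENNReal.ofReal (c * r ^ P.trace)) {p q α : ℝ} (hp : 1 < p)
    (hpq : p < q) (hα : 0 < α) {φ : (Fin n → ℝ) → ℝ → ℝ} (hpos : ∀ x r, 0 < r → 0 < φ x r)
    (hsup : MorreySupCondition P.trace φ) (hint : MorreyIntegralCondition α p q φ) :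
    ∃ A : ℝ≥0, ∀ (g : (Fin n → ℝ) → ℝ≥0∞) (N : ℝ≥0∞), Measurable g → N ≠ ∞ →
      (∀ x r, 0 < r → ∫⁻ y in ellipsoid ρ x r, g y ^ p ≤
        N ^ p * ENNReal.ofReal (φ x r * (c * r ^ P.trace))) →
      (∀ᵐ x, ellipsoidPotential ρ (P.trace - α) g x < ∞) ∧
      ∀ x r, 0 < r → ∫⁻ y in ellipsoid ρ x r, ellipsoidPotential ρ (P.trace - α) g y ^ q ≤
        (A * N) ^ q * ENNReal.ofReal (φ x r * (c * r ^ P.trace)) := by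
  have hp0 : 0 < p := by linarith
  have hq0 : 0 < q := by linarith
  obtain ⟨B, hB⟩ := h.exists_morrey_strong hγ hc hvol hp hpos hsup
  obtain ⟨A, hA0, hA⟩ := exists_ellipsoidPotential_le hc hvol hp.le hα hpos hint
  refine ⟨(2 * A).toNNReal * B ^ (1 / q), fun g N hg hN hM => ?_⟩
  have hMm : Measurable (weightedMaximal ρ (averageWeight c P.trace) g) :=
    h.measurable_weightedMaximal (averageWeight_antitoneOn hc hγ) hg
  have hMB := hB g N hg hN hM
  -- The balancing of radii is available only where M g is finite; the Morrey bound for M makes this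
  -- almost everywhere.
  have hfin : ∀ᵐ x, weightedMaximal ρ (averageWeight c P.trace) g x < ∞ := by
    refine ae_of_forall_ae_restrict_ellipsoid (ρ := ρ) fun r hr => ?_
    have h1 := (hMB 0 r hr).trans_lt (by finiteness)
    filter_upwards [ae_lt_top (hMm.pow_const p) h1.ne] with x hx
    exact (ENNReal.rpow_lt_top_iff_of_pos hp0).1 hx
  have hK : ∀ x, weightedMaximal ρ (averageWeight c P.trace) g x < ∞ →
      ellipsoidPotential ρ (P.trace - α) g x ≤ ENNReal.ofReal (2 * A) *
        (weightedMaximal ρ (averageWeight c P.trace) g x ^ (p / q) * N ^ (1 - p / q)) := fun x hx =>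
    ENNReal.le_mul_rpow_mul_rpow_of_forall_le hp0 hpq hα hx.ne hN hA0 fun r hr =>
      hA g N hg hN hM x r hr
  have hexp : 0 ≤ 1 - p / q := by rw [sub_nonneg, div_le_one hq0]; exact hpq.le
  have hqp : 0 ≤ q - p := by linarith
  refine ⟨?_, fun x r hr => ?_⟩
  · filter_upwards [hfin] with x hx
    refine (hK x hx).trans_lt ?_
    have := hx.ne
    have : 0 ≤ p / q := by positivity
    finiteness
  · calc ∫⁻ y in ellipsoid ρ x r, ellipsoidPotential ρ (P.trace - α) g y ^ q
        ≤ ∫⁻ y in ellipsoid ρ x r, ENNReal.ofReal (2 * A) ^ q * N ^ (q - p) *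
            weightedMaximal ρ (averageWeight c P.trace) g y ^ p := by
          refine lintegral_mono_ae ?_
          filter_upwards [ae_restrict_of_ae hfin] with y hy
          rw [← ENNReal.mul_rpow_div_mul_rpow_one_sub_rpow _ _ _ hp0 hpq]
          gcongr
          exact hK y hy
      _ ≤ ENNReal.ofReal (2 * A) ^ q * N ^ (q - p) *
            (B * (N ^ p * ENNReal.ofReal (φ x r * (c * r ^ P.trace)))) := by
          rw [lintegral_const_mul' _ _ (by finiteness)]
          gcongr
          exact hMB x r hr
      _ = _ := by
          rw [ENNReal.coe_mul_rpow_mul_rpow _ _ _ hp0 hpq, ENNReal.ofReal]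
          ring

/-- Adams-type estimate for the potential, `p = 1`. -/
lemma exists_potential_weak (h : IsParabolicQuasiDist P ρ) (hγ : 0 < P.trace) {c : ℝ}
    (hc : 0 < c)
    (hvol : ∀ (x : Fin n → ℝ) (r : ℝ), 0 < r →
      volume (ellipsoid ρ x r) = ENNReal.ofReal (c * r ^ P.trace)) {q α : ℝ}
    (hq : 1 < q) (hα : 0 < α) {φ : (Fin n → ℝ) → ℝ → ℝ} (hpos : ∀ x r, 0 < r → 0 < φ x r)
    (hsup : MorreySupCondition P.trace φ) (hint : MorreyIntegralCondition α 1 q φ) :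
    ∃ A : ℝ≥0, ∀ (g : (Fin n → ℝ) → ℝ≥0∞) (N : ℝ≥0∞), Measurable g → N ≠ ∞ →
      (∀ x r, 0 < r → ∫⁻ y in ellipsoid ρ x r, g y ^ (1 : ℝ) ≤
        N ^ (1 : ℝ) * ENNReal.ofReal (φ x r * (c * r ^ P.trace))) →
      (∀ᵐ x, ellipsoidPotential ρ (P.trace - α) g x < ∞) ∧
      ∀ x r, 0 < r → ∀ s : ℝ≥0, (s : ℝ≥0∞) ^ q *
          volume {y | y ∈ ellipsoid ρ x r ∧ s < ellipsoidPotential ρ (P.trace - α) g y} ≤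
        (A * N) ^ q * ENNReal.ofReal (φ x r * (c * r ^ P.trace)) := by
  have hq0 : 0 < q := by linarith
  obtain ⟨B, hB⟩ := h.exists_morrey_weak hγ hc hvol hpos hsup
  obtain ⟨A, hA0, hA⟩ := exists_ellipsoidPotential_le hc hvol le_rfl hα hpos hint
  refine ⟨(2 * A).toNNReal * B ^ (1 / q), fun g N hg hN hM => ?_⟩
  have hMB := hB g N hg hN (by simpa using hM)
  have hfin : ∀ᵐ x, weightedMaximal ρ (averageWeight c P.trace) g x < ∞ := by
    refine ae_of_forall_ae_restrict_ellipsoid (ρ := ρ) fun r hr => ?_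
    rw [ae_restrict_iff' (h.measurableSet_ellipsoid _ _), ae_iff]
    set S := {x | ¬(x ∈ ellipsoid ρ 0 r → weightedMaximal ρ (averageWeight c P.trace) g x < ∞)}
    set W := B * (N * ENNReal.ofReal (φ 0 r * (c * r ^ P.trace))) with hW
    have hWfin : W ≠ ∞ := by finiteness
    -- On S the maximal function is infinite, so S lies in every level set and m |S| ≤ W < ∞ for all
    -- m, which forces |S| = 0.
    have h1 : ∀ m : ℕ, (m : ℝ≥0∞) * volume S ≤ W := by
      intro m
      refine (mul_le_mul_right (measure_mono fun x hx => ?_) _).trans (hMB 0 r hr m)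
      simp only [S, mem_ofPred_eq, Classical.not_imp, not_lt, top_le_iff] at hx
      exact ⟨hx.1, by rw [hx.2]; exact ENNReal.natCast_lt_top m⟩
    by_contra h0
    obtain ⟨m, hm⟩ := ENNReal.exists_nat_mul_gt h0 hWfin
    exact absurd (h1 m) (not_le.2 hm)
  have hK : ∀ x, weightedMaximal ρ (averageWeight c P.trace) g x < ∞ →
      ellipsoidPotential ρ (P.trace - α) g x ≤ ENNReal.ofReal (2 * A) *
        (weightedMaximal ρ (averageWeight c P.trace) g x ^ (1 / q) * N ^ (1 - 1 / q)) := fun x hx =>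
    ENNReal.le_mul_rpow_mul_rpow_of_forall_le one_pos hq hα hx.ne hN hA0 fun r hr =>
      hA g N hg hN hM x r hr
  have hexp : 0 ≤ 1 - 1 / q := by rw [sub_nonneg, div_le_one hq0]; exact hq.le
  have hqp : 0 ≤ q - 1 := by linarith
  refine ⟨?_, fun x r hr s => ?_⟩
  · filter_upwards [hfin] with x hx
    refine (hK x hx).trans_lt ?_
    have := hx.ne
    have : 0 ≤ 1 / q := by positivity
    finiteness
  · set L := ENNReal.ofReal (2 * A) ^ q * N ^ (q - 1) with hL
    have hLfin : L ≠ ∞ := by finiteness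
    have hae : volume {y | y ∈ ellipsoid ρ x r ∧ s < ellipsoidPotential ρ (P.trace - α) g y} ≤
        volume {y | y ∈ ellipsoid ρ x r ∧
          (s : ℝ≥0∞) ^ q < L * weightedMaximal ρ (averageWeight c P.trace) g y} := by
      refine measure_mono_ae ?_
      filter_upwards [hfin] with y hy hy'
      obtain ⟨h1, h2⟩ := hy'
      refine ⟨h1, ?_⟩
      have h3 := ENNReal.rpow_lt_rpow (h2.trans_le (hK y hy)) hq0
      rwa [ENNReal.mul_rpow_div_mul_rpow_one_sub_rpow _ _ _ one_pos hq, ENNReal.rpow_one] at h3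
    refine (mul_le_mul_right hae _).trans ?_
    have e : (((2 * A).toNNReal * B ^ (1 / q) : ℝ≥0) * N : ℝ≥0∞) ^ q *
        ENNReal.ofReal (φ x r * (c * r ^ P.trace)) =
        L * (B * (N * ENNReal.ofReal (φ x r * (c * r ^ P.trace)))) := by
      rw [ENNReal.coe_mul_rpow_mul_rpow _ _ _ one_pos hq, ENNReal.rpow_one, hL]
      simp only [ENNReal.ofReal]
      ring
    rw [e]
    -- For L = 0 the set is empty; otherwise the weak bound for M is applied at level s^q / L.
    rcases eq_or_ne L 0 with h0 | h0
    · simp [h0]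
    · have hset : {y | y ∈ ellipsoid ρ x r ∧
          (s : ℝ≥0∞) ^ q < L * weightedMaximal ρ (averageWeight c P.trace) g y} =
          {y | y ∈ ellipsoid ρ x r ∧
            (s : ℝ≥0∞) ^ q / L < weightedMaximal ρ (averageWeight c P.trace) g y} := by
        ext y
        simp only [mem_ofPred_eq, ENNReal.div_lt_iff (Or.inl h0) (Or.inl hLfin)]
        rw [mul_comm L]
      calc (s : ℝ≥0∞) ^ q * volume {y | y ∈ ellipsoid ρ x r ∧
            (s : ℝ≥0∞) ^ q < L * weightedMaximal ρ (averageWeight c P.trace) g y}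
          = L * ((s : ℝ≥0∞) ^ q / L * volume {y | y ∈ ellipsoid ρ x r ∧
            (s : ℝ≥0∞) ^ q / L < weightedMaximal ρ (averageWeight c P.trace) g y}) := by
            rw [hset, ← mul_assoc, ENNReal.mul_div_cancel h0 hLfin]
        _ ≤ _ := by
            gcongr _ * ?_
            exact hMB x r hr _

end IsParabolicQuasiDist

/-! ### Morrey norms as integral and level-set inequalities. -/

section MorreyNorms

variable {n : ℕ} {ε : Type*} [TopologicalSpace ε] [ContinuousENorm ε] {ρ : (Fin n → ℝ) → ℝ}
  {φ : (Fin n → ℝ) → ℝ → ℝ}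

lemma ENNReal.ofReal_inv_mul_rpow_neg {a p : ℝ} (ha : 0 < a) (hp : 0 < p) (V : ℝ) :
    ENNReal.ofReal (a ^ (1 / p))⁻¹ * ENNReal.ofReal V ^ (-(1 / p)) =
      (ENNReal.ofReal (a * V) ^ (1 / p))⁻¹ := by
  have h1 : 0 < a ^ (1 / p) := Real.rpow_pos_of_pos ha _
  rw [ENNReal.ofReal_inv_of_pos h1, ENNReal.rpow_neg, ENNReal.ofReal_mul ha.le,
    ENNReal.mul_rpow_of_nonneg _ _ (by positivity), ← ENNReal.ofReal_rpow_of_nonneg ha.le (by positivity),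
    ENNReal.mul_inv (Or.inl (by simp [ha])) (Or.inl (by finiteness))]

lemma ENNReal.inv_rpow_mul_rpow_le_iff {a p : ℝ} (ha : 0 < a) (hp : 0 < p) (S B : ℝ≥0∞) :
    (ENNReal.ofReal a ^ (1 / p))⁻¹ * S ^ (1 / p) ≤ B ↔ S ≤ B ^ p * ENNReal.ofReal a := by
  have ha' : ENNReal.ofReal a ^ (1 / p) ≠ 0 := by
    simp [ENNReal.rpow_eq_zero_iff, ha]
  have hat : ENNReal.ofReal a ^ (1 / p) ≠ ∞ := by finiteness
  rw [← ENNReal.div_eq_inv_mul, ENNReal.div_le_iff ha' hat,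
    ← ENNReal.rpow_le_rpow_iff hp, ← ENNReal.rpow_mul, one_div_mul_cancel hp.ne', ENNReal.rpow_one,
    ENNReal.mul_rpow_of_nonneg _ _ hp.le, ← ENNReal.rpow_mul, one_div_mul_cancel hp.ne',
    ENNReal.rpow_one]

lemma strongNormOn_eq {p : ℝ} (hp : 0 < p) (f : (Fin n → ℝ) → ε) (E : Set (Fin n → ℝ)) :
    strongNormOn p f E = (∫⁻ y in E, ‖f y‖ₑ ^ p) ^ (1 / p) := by
  rw [strongNormOn, eLpNorm_eq_lintegral_rpow_enorm_toReal (by simpa using hp)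
    ENNReal.ofReal_ne_top, ENNReal.toReal_ofReal hp.le]

lemma strongNormOn_mono {p : ℝ} (f : (Fin n → ℝ) → ε) {E F : Set (Fin n → ℝ)} (h : E ⊆ F) :
    strongNormOn p f E ≤ strongNormOn p f F :=
  eLpNorm_mono_measure f (Measure.restrict_mono h le_rfl)

lemma weakNormOn_mono {p : ℝ} (hp : 0 < p) (f : (Fin n → ℝ) → ε) {E F : Set (Fin n → ℝ)}
    (h : E ⊆ F) : weakNormOn p f E ≤ weakNormOn p f F := by
  refine iSup_mono fun s => ?_
  gcongr _ * volume ?_ ^ _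
  exact fun y hy => ⟨h hy.1, hy.2⟩

/-- With φ^(1/p) as weight, p-th powers are compared with φ(x,r)|E(x,r)|, which does not depend on
p. Hence the bound for (M g)^p is already of the form required of the q-th power of the potential.
-/
lemma morreyNorm_rpow_le_iff {γ c : ℝ} (hc : 0 < c)
    (hvol : ∀ (x : Fin n → ℝ) (r : ℝ), 0 < r →
      volume (ellipsoid ρ x r) = ENNReal.ofReal (c * r ^ γ))
    (hpos : ∀ x r, 0 < r → 0 < φ x r) {p : ℝ} (hp : 0 < p) (f : (Fin n → ℝ) → ε) (B : ℝ≥0∞) :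
    morreyNorm ρ p (fun x r => φ x r ^ (1 / p)) f ≤ B ↔
      ∀ x r, 0 < r → ∫⁻ y in ellipsoid ρ x r, ‖f y‖ₑ ^ p ≤
        B ^ p * ENNReal.ofReal (φ x r * (c * r ^ γ)) := by
  simp only [morreyNorm, iSup_le_iff]
  refine forall_congr' fun x => forall_congr' fun r => forall_congr' fun hr => ?_
  have hV : 0 < c * r ^ γ := mul_pos hc (Real.rpow_pos_of_pos hr _)
  rw [hvol x r hr, ENNReal.ofReal_inv_mul_rpow_neg (hpos x r hr) hp, strongNormOn_eq hp,
    ENNReal.inv_rpow_mul_rpow_le_iff (mul_pos (hpos x r hr) hV) hp]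

lemma weakMorreyNorm_rpow_le_iff {γ c : ℝ} (hc : 0 < c)
    (hvol : ∀ (x : Fin n → ℝ) (r : ℝ), 0 < r →
      volume (ellipsoid ρ x r) = ENNReal.ofReal (c * r ^ γ))
    (hpos : ∀ x r, 0 < r → 0 < φ x r) {p : ℝ} (hp : 0 < p) (f : (Fin n → ℝ) → ε) (B : ℝ≥0∞) :
    weakMorreyNorm ρ p (fun x r => φ x r ^ (1 / p)) f ≤ B ↔
      ∀ x r, 0 < r → ∀ s : ℝ≥0,
        (s : ℝ≥0∞) ^ p * volume {y | y ∈ ellipsoid ρ x r ∧ (s : ℝ≥0∞) < ‖f y‖ₑ} ≤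
        B ^ p * ENNReal.ofReal (φ x r * (c * r ^ γ)) := by
  simp only [weakMorreyNorm, iSup_le_iff]
  refine forall_congr' fun x => forall_congr' fun r => forall_congr' fun hr => ?_
  have hV : 0 < c * r ^ γ := mul_pos hc (Real.rpow_pos_of_pos hr _)
  rw [hvol x r hr, ENNReal.ofReal_inv_mul_rpow_neg (hpos x r hr) hp, weakNormOn,
    ENNReal.mul_iSup, iSup_le_iff]
  refine forall_congr' fun s => ?_
  rw [← ENNReal.inv_rpow_mul_rpow_le_iff (mul_pos (hpos x r hr) hV) hp,
    ENNReal.mul_rpow_of_nonneg _ _ (by positivity), ← ENNReal.rpow_mul, mul_one_div_cancel hp.ne',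
    ENNReal.rpow_one]

lemma strongNormOn_lt_top_of_morreyNorm_rpow {P : Matrix (Fin n) (Fin n) ℝ}
    (h : IsParabolicQuasiDist P ρ) {c : ℝ} (hc : 0 < c)
    (hvol : ∀ (x : Fin n → ℝ) (r : ℝ), 0 < r →
      volume (ellipsoid ρ x r) = ENNReal.ofReal (c * r ^ P.trace))
    (hpos : ∀ x r, 0 < r → 0 < φ x r) {p : ℝ} (hp : 0 < p) {f : (Fin n → ℝ) → ε}
    (hf : morreyNorm ρ p (fun x r => φ x r ^ (1 / p)) f < ∞) {K : Set (Fin n → ℝ)}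
    (hK : IsCompact K) : strongNormOn p f K < ∞ := by
  obtain ⟨r, hr, hKr⟩ := h.exists_subset_ellipsoid hK
  refine (strongNormOn_mono f hKr).trans_lt ?_
  rw [strongNormOn_eq hp]
  have h1 := (morreyNorm_rpow_le_iff hc hvol hpos hp f _).1 le_rfl 0 r hr
  have := hf.ne
  have h2 : ∫⁻ y in ellipsoid ρ 0 r, ‖f y‖ₑ ^ p ≠ ∞ := ne_top_of_le_ne_top (by finiteness) h1
  have : 0 ≤ 1 / p := by positivity
  finiteness

lemma weakNormOn_lt_top_of_weakMorreyNorm_rpow {P : Matrix (Fin n) (Fin n) ℝ}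
    (h : IsParabolicQuasiDist P ρ) {c : ℝ} (hc : 0 < c)
    (hvol : ∀ (x : Fin n → ℝ) (r : ℝ), 0 < r →
      volume (ellipsoid ρ x r) = ENNReal.ofReal (c * r ^ P.trace))
    (hpos : ∀ x r, 0 < r → 0 < φ x r) {p : ℝ} (hp : 0 < p) {f : (Fin n → ℝ) → ε}
    (hf : weakMorreyNorm ρ p (fun x r => φ x r ^ (1 / p)) f < ∞) {K : Set (Fin n → ℝ)}
    (hK : IsCompact K) : weakNormOn p f K < ∞ := by
  obtain ⟨r, hr, hKr⟩ := h.exists_subset_ellipsoid hK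
  refine (weakNormOn_mono hp f hKr).trans_lt ?_
  have hBne := hf.ne
  set B := weakMorreyNorm ρ p (fun x r => φ x r ^ (1 / p)) f with hB
  have h1 := (weakMorreyNorm_rpow_le_iff hc hvol hpos hp f _).1 hB.symm.le 0 r hr
  have hp' : 0 ≤ 1 / p := by positivity
  have h2 : (B ^ p * ENNReal.ofReal (φ 0 r * (c * r ^ P.trace))) ^ (1 / p) < ∞ := by finiteness
  refine lt_of_le_of_lt (iSup_le fun s => ?_) h2
  have h3 := ENNReal.rpow_le_rpow (h1 s) hp'
  rwa [ENNReal.mul_rpow_of_nonneg _ _ hp', ← ENNReal.rpow_mul, mul_one_div_cancel hp.ne',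
    ENNReal.rpow_one] at h3

/-- A function dominated by one satisfying the strong Morrey estimate lies in the Morrey space. -/
lemma memMorrey_rpow_of_enorm_le {P : Matrix (Fin n) (Fin n) ℝ}
    (h : IsParabolicQuasiDist P ρ) {c : ℝ} (hc : 0 < c)
    (hvol : ∀ (x : Fin n → ℝ) (r : ℝ), 0 < r →
      volume (ellipsoid ρ x r) = ENNReal.ofReal (c * r ^ P.trace))
    (hpos : ∀ x r, 0 < r → 0 < φ x r) {p : ℝ} (hp : 0 < p) {f : (Fin n → ℝ) → ε}
    (hf : AEStronglyMeasurable f volume) {K : (Fin n → ℝ) → ℝ≥0∞} {D : ℝ≥0} {B : ℝ≥0∞} (hB : B ≠ ∞)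
    (hfK : ∀ x, ‖f x‖ₑ ≤ D * K x)
    (hK : ∀ x r, 0 < r → ∫⁻ y in ellipsoid ρ x r, K y ^ p ≤
      B ^ p * ENNReal.ofReal (φ x r * (c * r ^ P.trace))) :
    MemMorrey ρ p (fun x r => φ x r ^ (1 / p)) f ∧
      morreyNorm ρ p (fun x r => φ x r ^ (1 / p)) f ≤ D * B := by
  have hle : morreyNorm ρ p (fun x r => φ x r ^ (1 / p)) f ≤ D * B := by
    refine (morreyNorm_rpow_le_iff hc hvol hpos hp f _).2 fun x r hr => ?_
    calc ∫⁻ y in ellipsoid ρ x r, ‖f y‖ₑ ^ p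
        ≤ ∫⁻ y in ellipsoid ρ x r, (D : ℝ≥0∞) ^ p * K y ^ p := by
          refine lintegral_mono fun y => ?_
          rw [← ENNReal.mul_rpow_of_nonneg _ _ hp.le]
          gcongr
          exact hfK y
      _ ≤ (D : ℝ≥0∞) ^ p * (B ^ p * ENNReal.ofReal (φ x r * (c * r ^ P.trace))) := by
          rw [lintegral_const_mul' _ _ (by finiteness)]
          gcongr
          exact hK x r hr
      _ = _ := by rw [ENNReal.mul_rpow_of_nonneg _ _ hp.le, mul_assoc]
  have hlt := hle.trans_lt (by finiteness)
  exact ⟨⟨hf, fun _ hKc => strongNormOn_lt_top_of_morreyNorm_rpow h hc hvol hpos hp hlt hKc, hlt⟩, hle⟩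

/-- A function dominated by one satisfying the weak Morrey estimate lies in the weak space. -/
lemma memWeakMorrey_rpow_of_enorm_le {P : Matrix (Fin n) (Fin n) ℝ}
    (h : IsParabolicQuasiDist P ρ) {c : ℝ} (hc : 0 < c)
    (hvol : ∀ (x : Fin n → ℝ) (r : ℝ), 0 < r →
      volume (ellipsoid ρ x r) = ENNReal.ofReal (c * r ^ P.trace))
    (hpos : ∀ x r, 0 < r → 0 < φ x r) {p : ℝ} (hp : 0 < p) {f : (Fin n → ℝ) → ε}
    (hf : AEStronglyMeasurable f volume) {K : (Fin n → ℝ) → ℝ≥0∞} {D : ℝ≥0} (hD : D ≠ 0)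
    {B : ℝ≥0∞} (hB : B ≠ ∞) (hfK : ∀ x, ‖f x‖ₑ ≤ D * K x)
    (hK : ∀ x r, 0 < r → ∀ s : ℝ≥0, (s : ℝ≥0∞) ^ p *
      volume {y | y ∈ ellipsoid ρ x r ∧ (s : ℝ≥0∞) < K y} ≤
      B ^ p * ENNReal.ofReal (φ x r * (c * r ^ P.trace))) :
    MemWeakMorrey ρ p (fun x r => φ x r ^ (1 / p)) f ∧
      weakMorreyNorm ρ p (fun x r => φ x r ^ (1 / p)) f ≤ D * B := by
  have hle : weakMorreyNorm ρ p (fun x r => φ x r ^ (1 / p)) f ≤ D * B := by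
    refine (weakMorreyNorm_rpow_le_iff hc hvol hpos hp f _).2 fun x r hr s => ?_
    have hD' : (D : ℝ≥0∞) ≠ 0 := by exact_mod_cast hD
    -- The level is rescaled by D: s < ‖f‖ ≤ D K forces s/D < K, which is where D ≠ 0 enters.
    have hs : (s : ℝ≥0∞) = D * (s / D : ℝ≥0) := by
      rw [← ENNReal.coe_mul, mul_div_cancel₀ _ hD]
    calc (s : ℝ≥0∞) ^ p * volume {y | y ∈ ellipsoid ρ x r ∧ (s : ℝ≥0∞) < ‖f y‖ₑ}
        ≤ (s : ℝ≥0∞) ^ p * volume {y | y ∈ ellipsoid ρ x r ∧ ((s / D : ℝ≥0) : ℝ≥0∞) < K y} := by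
          gcongr _ * volume ?_
          rintro y ⟨hy, hys⟩
          refine ⟨hy, ?_⟩
          have := hys.trans_le (hfK y)
          rw [hs] at this
          exact (ENNReal.mul_lt_mul_iff_right hD' ENNReal.coe_ne_top).1 this
      _ = (D : ℝ≥0∞) ^ p * (((s / D : ℝ≥0) : ℝ≥0∞) ^ p *
            volume {y | y ∈ ellipsoid ρ x r ∧ ((s / D : ℝ≥0) : ℝ≥0∞) < K y}) := by
          rw [← mul_assoc, ← ENNReal.mul_rpow_of_nonneg _ _ hp.le, ← hs]
      _ ≤ (D : ℝ≥0∞) ^ p * (B ^ p * ENNReal.ofReal (φ x r * (c * r ^ P.trace))) := by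
          gcongr _ * ?_
          exact hK x r hr _
      _ = _ := by rw [ENNReal.mul_rpow_of_nonneg _ _ hp.le, mul_assoc]
  have hlt := hle.trans_lt (by finiteness)
  exact ⟨⟨hf, fun _ hKc => weakNormOn_lt_top_of_weakMorreyNorm_rpow h hc hvol hpos hp hlt hKc, hlt⟩, hle⟩

end MorreyNorms

/-! ### Measurability of the two operators and their domination by the potential. -/

section Operators

variable {n : ℕ} {P : Matrix (Fin n) (Fin n) ℝ} {ρ : (Fin n → ℝ) → ℝ} {𝕜 : Type*} [RCLike 𝕜]

/-- Integrals ignore null sets, so the equality holds at every point even though g is only an almost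
everywhere representative of ‖f‖; measurability for Borel g is thereby inherited. -/
lemma parabolicFracMaximal_eq_weightedMaximal {c : ℝ}
    (hvol : ∀ (x : Fin n → ℝ) (r : ℝ), 0 < r →
      volume (ellipsoid ρ x r) = ENNReal.ofReal (c * r ^ P.trace)) (α : ℝ) {f : (Fin n → ℝ) → 𝕜}
    {g : (Fin n → ℝ) → ℝ≥0∞} (hfg : (fun y => ‖f y‖ₑ) =ᵐ[volume] g) :
    parabolicFracMaximal P ρ α f = weightedMaximal ρ
      (fun t => ENNReal.ofReal (c * t ^ P.trace) ^ (-1 + α / P.trace)) g := by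
  ext x
  refine iSup_congr fun t => iSup_congr fun ht => ?_
  rw [hvol x t ht, lintegral_congr_ae (ae_restrict_of_ae hfg)]

lemma measurable_parabolicFracMaximal (h : IsParabolicQuasiDist P ρ) {c : ℝ} (hc : 0 < c)
    (hvol : ∀ (x : Fin n → ℝ) (r : ℝ), 0 < r →
      volume (ellipsoid ρ x r) = ENNReal.ofReal (c * r ^ P.trace)) {α : ℝ} (hγ : 0 < P.trace)
    (hαγ : α < P.trace) {f : (Fin n → ℝ) → 𝕜} {g : (Fin n → ℝ) → ℝ≥0∞} (hg : Measurable g)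
    (hfg : (fun y => ‖f y‖ₑ) =ᵐ[volume] g) : Measurable (parabolicFracMaximal P ρ α f) := by
  rw [parabolicFracMaximal_eq_weightedMaximal hvol α hfg]
  refine h.measurable_weightedMaximal (fun s hs t ht hst => ?_) hg
  have hs' : (0 : ℝ) < s := hs
  have : -1 + α / P.trace ≤ 0 := by
    have := (div_le_one hγ).2 hαγ.le
    linarith
  rw [← neg_neg (-1 + α / P.trace), ENNReal.rpow_neg _ (-_), ENNReal.rpow_neg _ (-_),
    ENNReal.inv_le_inv]
  exact ENNReal.rpow_le_rpow (by gcongr) (by linarith)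

/-- The weight |E(x,t)|^(-1+α/γ) is a constant multiple of t^(-(γ-α)), the power that the potential
controls. -/
lemma parabolicFracMaximal_le_ellipsoidPotential {c : ℝ} (hc : 0 < c)
    (hvol : ∀ (x : Fin n → ℝ) (r : ℝ), 0 < r →
      volume (ellipsoid ρ x r) = ENNReal.ofReal (c * r ^ P.trace)) {α : ℝ} (hγ : 0 < P.trace)
    (hαγ : α < P.trace) {f : (Fin n → ℝ) → 𝕜} {g : (Fin n → ℝ) → ℝ≥0∞}
    (hfg : (fun y => ‖f y‖ₑ) =ᵐ[volume] g) (x : Fin n → ℝ) :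
    parabolicFracMaximal P ρ α f x ≤
      ENNReal.ofReal (c ^ (-1 + α / P.trace) * (P.trace - α)) *
        ellipsoidPotential ρ (P.trace - α) g x := by
  rw [parabolicFracMaximal_eq_weightedMaximal hvol α hfg]
  refine iSup₂_le fun t ht => ?_
  beta_reduce
  have e : ENNReal.ofReal (c * t ^ P.trace) ^ (-1 + α / P.trace) =
      ENNReal.ofReal (c ^ (-1 + α / P.trace)) * ENNReal.ofReal (t ^ (-(P.trace - α))) := by
    have ht' := Real.rpow_pos_of_pos ht P.trace
    rw [ENNReal.ofReal_rpow_of_pos (by positivity), ← ENNReal.ofReal_mul (by positivity),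
      Real.mul_rpow hc.le ht'.le, ← Real.rpow_mul ht.le]
    congr 3
    field_simp
    ring
  rw [e, mul_assoc, ENNReal.ofReal_mul (by positivity), mul_assoc]
  gcongr _ * ?_
  exact rpow_mul_setLIntegral_le_ellipsoidPotential (sub_pos.2 hαγ) g x ht

lemma lintegral_enorm_parabolicFracKernel_le (h : IsParabolicQuasiDist P ρ) {α : ℝ}
    (hαγ : α < P.trace) {f : (Fin n → ℝ) → 𝕜} {g : (Fin n → ℝ) → ℝ≥0∞} (hg : Measurable g)
    (hfg : (fun y => ‖f y‖ₑ) =ᵐ[volume] g) (x : Fin n → ℝ) :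
    ∫⁻ y, ‖parabolicFracKernel P ρ α f x y‖ₑ ≤
      ENNReal.ofReal (P.trace - α) * ellipsoidPotential ρ (P.trace - α) g x := by
  refine le_trans (lintegral_mono_ae ?_)
    (h.lintegral_kernel_le_ellipsoidPotential (sub_pos.2 hαγ) hg x)
  filter_upwards [hfg] with y hy
  rw [parabolicFracKernel, enorm_smul, hy, Real.enorm_of_nonneg]
  exact inv_nonneg.2 (Real.rpow_nonneg (h.nonneg _) _)

lemma aestronglyMeasurable_parabolicFracKernel (h : IsParabolicQuasiDist P ρ) (α : ℝ)
    {f : (Fin n → ℝ) → 𝕜} (hf : AEStronglyMeasurable f volume) (x : Fin n → ℝ) :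
    AEStronglyMeasurable (parabolicFracKernel P ρ α f x) volume := by
  have h1 : Measurable fun y : Fin n → ℝ => (ρ (x - y) ^ (P.trace - α))⁻¹ :=
    ((h.measurable.comp (measurable_const.sub measurable_id)).pow_const _).inv
  exact h1.aestronglyMeasurable.smul hf

lemma aestronglyMeasurable_parabolicFracIntegral (h : IsParabolicQuasiDist P ρ) (α : ℝ)
    {f : (Fin n → ℝ) → 𝕜} (hf : AEStronglyMeasurable f volume) :
    AEStronglyMeasurable (parabolicFracIntegral P ρ α f) volume := by
  have h1 : Measurable fun z : (Fin n → ℝ) × (Fin n → ℝ) =>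
      (ρ (z.1 - z.2) ^ (P.trace - α))⁻¹ :=
    ((h.measurable.comp (measurable_fst.sub measurable_snd)).pow_const _).inv
  exact (h1.aestronglyMeasurable.smul hf.comp_snd).integral_prod_right'

lemma integrable_parabolicFracKernel (h : IsParabolicQuasiDist P ρ) {α : ℝ}
    (hαγ : α < P.trace) {f : (Fin n → ℝ) → 𝕜} (hf : AEStronglyMeasurable f volume)
    {g : (Fin n → ℝ) → ℝ≥0∞} (hg : Measurable g) (hfg : (fun y => ‖f y‖ₑ) =ᵐ[volume] g)
    {x : Fin n → ℝ} (hx : ellipsoidPotential ρ (P.trace - α) g x < ∞) :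
    Integrable (parabolicFracKernel P ρ α f x) := by
  refine ⟨aestronglyMeasurable_parabolicFracKernel h α hf x, ?_⟩
  have := hx.ne
  exact (lintegral_enorm_parabolicFracKernel_le h hαγ hg hfg x).trans_lt (by finiteness)

end Operators

/-! ### The main theorem. -/

theorem corollary1p9 {𝕜 : Type*} [RCLike 𝕜] (n : ℕ) (hn : 2 ≤ n)
    (P : Matrix (Fin n) (Fin n) ℝ)
    (hP : ∀ z ∈ spectrum ℂ (P.map (algebraMap ℝ ℂ)), 0 < z.re)
    (ρ : (Fin n → ℝ) → ℝ) (hρ : IsParabolicQuasiDist P ρ)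
    (p q α : ℝ) (hp : 1 ≤ p) (hpq : p < q) (hα : 0 < α) (hαp : α < P.trace / p)
    (φ : (Fin n → ℝ) → ℝ → ℝ) (hφ_pos : ∀ x r, 0 < r → 0 < φ x r)
    (hφ_meas : Measurable (fun z : (Fin n → ℝ) × Ioi (0 : ℝ) => φ z.1 (z.2 : ℝ)))
    (hφ_sup : MorreySupCondition P.trace φ)
    (hφ_int : MorreyIntegralCondition α p q φ) :
    (1 < p →
      ∃ C : ℝ≥0, ∀ f : (Fin n → ℝ) → 𝕜,
        MemMorrey ρ p (fun x r => φ x r ^ (1 / p)) f →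
        (MemMorrey ρ q (fun x r => φ x r ^ (1 / q)) (parabolicFracMaximal P ρ α f) ∧
          morreyNorm ρ q (fun x r => φ x r ^ (1 / q)) (parabolicFracMaximal P ρ α f)
            ≤ C * morreyNorm ρ p (fun x r => φ x r ^ (1 / p)) f) ∧
        ((∀ᵐ x, Integrable (parabolicFracKernel P ρ α f x)) ∧
          MemMorrey ρ q (fun x r => φ x r ^ (1 / q)) (parabolicFracIntegral P ρ α f) ∧
          morreyNorm ρ q (fun x r => φ x r ^ (1 / q)) (parabolicFracIntegral P ρ α f)
            ≤ C * morreyNorm ρ p (fun x r => φ x r ^ (1 / p)) f)) ∧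
    (p = 1 →
      ∃ C : ℝ≥0, ∀ f : (Fin n → ℝ) → 𝕜,
        MemMorrey ρ 1 φ f →
        (MemWeakMorrey ρ q (fun x r => φ x r ^ (1 / q)) (parabolicFracMaximal P ρ α f) ∧
          weakMorreyNorm ρ q (fun x r => φ x r ^ (1 / q)) (parabolicFracMaximal P ρ α f)
            ≤ C * morreyNorm ρ 1 φ f) ∧
        ((∀ᵐ x, Integrable (parabolicFracKernel P ρ α f x)) ∧
          MemWeakMorrey ρ q (fun x r => φ x r ^ (1 / q)) (parabolicFracIntegral P ρ α f) ∧
          weakMorreyNorm ρ q (fun x r => φ x r ^ (1 / q)) (parabolicFracIntegral P ρ α f)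
            ≤ C * morreyNorm ρ 1 φ f)) := by
  have : NeZero n := ⟨by omega⟩
  have hp0 : 0 < p := by linarith
  have hq0 : 0 < q := by linarith
  -- Positivity of the trace is read off 0 < α < γ/p rather than from the eigenvalues.
  have hγ : 0 < P.trace := by
    have := (lt_div_iff₀ hp0).1 (hα.trans hαp)
    linarith
  have hαγ : α < P.trace := hαp.trans_le (div_le_self hγ.le hp)
  have hβ : 0 < P.trace - α := sub_pos.2 hαγ
  obtain ⟨c, hc, hvol⟩ := hρ.exists_volume_ellipsoid hP
  set D₁ : ℝ≥0 := (c ^ (-1 + α / P.trace) * (P.trace - α)).toNNReal with hD₁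
  set D₂ : ℝ≥0 := (P.trace - α).toNNReal with hD₂
  have hD₁0 : D₁ ≠ 0 := by
    have : 0 < c ^ (-1 + α / P.trace) * (P.trace - α) := by positivity
    simpa [hD₁] using this
  have hD₂0 : D₂ ≠ 0 := by simpa [hD₂] using hβ
  have hM : ∀ (f : (Fin n → ℝ) → 𝕜) (g : (Fin n → ℝ) → ℝ≥0∞), (fun y => ‖f y‖ₑ) =ᵐ[volume] g →
      ∀ x, ‖parabolicFracMaximal P ρ α f x‖ₑ ≤ D₁ * ellipsoidPotential ρ (P.trace - α) g x :=
    fun f g hfg x => parabolicFracMaximal_le_ellipsoidPotential hc hvol hγ hαγ hfg x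
  have hI : ∀ (f : (Fin n → ℝ) → 𝕜) (g : (Fin n → ℝ) → ℝ≥0∞), Measurable g →
      (fun y => ‖f y‖ₑ) =ᵐ[volume] g →
      ∀ x, ‖parabolicFracIntegral P ρ α f x‖ₑ ≤ D₂ * ellipsoidPotential ρ (P.trace - α) g x :=
    fun f g hg hfg x => (enorm_integral_le_lintegral_enorm _).trans
      (lintegral_enorm_parabolicFracKernel_le hρ hαγ hg hfg x)
  have hconst : ∀ (A : ℝ≥0) (N : ℝ≥0∞),
      D₁ * (A * N) ≤ (max D₁ D₂ * A : ℝ≥0) * N ∧ D₂ * (A * N) ≤ (max D₁ D₂ * A : ℝ≥0) * N := by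
    intro A N
    constructor <;>
    · rw [← mul_assoc, ← ENNReal.coe_mul]
      gcongr
      first | exact le_max_left _ _ | exact le_max_right _ _
  -- The potential estimates require a Borel g, whereas ‖f‖ is only almost everywhere measurable, so
  -- a measurable representative is used.
  have hsource : ∀ f : (Fin n → ℝ) → 𝕜, AEStronglyMeasurable f volume →
      ∃ g : (Fin n → ℝ) → ℝ≥0∞, Measurable g ∧ (fun y => ‖f y‖ₑ) =ᵐ[volume] g ∧
        ∀ x r, 0 < r → ∫⁻ y in ellipsoid ρ x r, g y ^ p ≤
          morreyNorm ρ p (fun x r => φ x r ^ (1 / p)) f ^ p *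
            ENNReal.ofReal (φ x r * (c * r ^ P.trace)) := by
    intro f hf
    refine ⟨hf.enorm.mk _, hf.enorm.measurable_mk, hf.enorm.ae_eq_mk, fun x r hr => ?_⟩
    refine le_trans (le_of_eq (lintegral_congr_ae (ae_restrict_of_ae ?_)))
      ((morreyNorm_rpow_le_iff hc hvol hφ_pos hp0 f _).1 le_rfl x r hr)
    filter_upwards [hf.enorm.ae_eq_mk] with y hy
    rw [← hy]
  refine ⟨fun hp1 => ?_, fun hp1 => ?_⟩
  · obtain ⟨A, hA⟩ := hρ.exists_potential_strong hγ hc hvol hp1 hpq hα hφ_pos hφ_sup hφ_int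
    refine ⟨max D₁ D₂ * A, fun f hf => ?_⟩
    obtain ⟨g, hg, hfg, hgN⟩ := hsource f hf.1
    have hN := hf.2.2.ne
    obtain ⟨hfin, hK⟩ := hA g _ hg hN hgN
    obtain ⟨hM1, hM2⟩ := memMorrey_rpow_of_enorm_le hρ hc hvol hφ_pos hq0
      (measurable_parabolicFracMaximal hρ hc hvol hγ hαγ hg hfg).aestronglyMeasurable
      (by finiteness) (hM f g hfg) hK
    obtain ⟨hI1, hI2⟩ := memMorrey_rpow_of_enorm_le hρ hc hvol hφ_pos hq0
      (aestronglyMeasurable_parabolicFracIntegral hρ α hf.1) (by finiteness) (hI f g hg hfg) hK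
    exact ⟨⟨hM1, hM2.trans (hconst A _).1⟩,
      hfin.mono fun x hx => integrable_parabolicFracKernel hρ hαγ hf.1 hg hfg hx,
      hI1, hI2.trans (hconst A _).2⟩
  · subst hp1
    obtain ⟨A, hA⟩ := hρ.exists_potential_weak hγ hc hvol hpq hα hφ_pos hφ_sup hφ_int
    refine ⟨max D₁ D₂ * A, fun f hf => ?_⟩
    obtain ⟨g, hg, hfg, hgN⟩ := hsource f hf.1
    have hφ1 : (fun x r => φ x r ^ ((1 : ℝ) / 1)) = φ := by
      ext x r
      rw [div_one, Real.rpow_one]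
    rw [hφ1] at hgN
    have hN := hf.2.2.ne
    obtain ⟨hfin, hK⟩ := hA g _ hg hN hgN
    obtain ⟨hM1, hM2⟩ := memWeakMorrey_rpow_of_enorm_le hρ hc hvol hφ_pos hq0
      (measurable_parabolicFracMaximal hρ hc hvol hγ hαγ hg hfg).aestronglyMeasurable hD₁0
      (by finiteness) (hM f g hfg) hK
    obtain ⟨hI1, hI2⟩ := memWeakMorrey_rpow_of_enorm_le hρ hc hvol hφ_pos hq0
      (aestronglyMeasurable_parabolicFracIntegral hρ α hf.1) hD₂0 (by finiteness)
      (hI f g hg hfg) hK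
    exact ⟨⟨hM1, hM2.trans (hconst A _).1⟩,
      hfin.mono fun x hx => integrable_parabolicFracKernel hρ hαγ hf.1 hg hfg hx,
      hI1, hI2.trans (hconst A _).2⟩
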